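/- Let $(\mathcal B,\mathbb E,\mathfrak s)$ be an extriangulated category (in the sense of Nakaoka–Palu: $\mathcal B$ is an additive category, $\mathbb E\colon\mathcal B^{\mathrm{op}}\times\mathcal B\to \mathit{Ab}$ an additive bifunctor, $\mathfrak s$ an additive realization, subject to (ET3), (ET3)$^{\mathrm{op}}$, (ET4), (ET4)$^{\mathrm{op}}$). A conflation $A\rightarrowtail B\twoheadrightarrow C$ is a sequence realizing some $\delta\in\mathbb E(C,A)$; an object $P$ is projective if $\mathbb E(P,-)=0$. Assume that $\mathcal B$ has enough projectives, i.e. every $B\in\mathcal B$ admits a conflation $K\rightarrowtail P\twoheadrightarrow B$ with $P$ projective. All subcategories are full. For subcategories $\mathcal X,\mathcal Y\subseteq\mathcal B$ let $\mathrm{Cone}(\mathcal X,\mathcal Y)$ (resp. $\mathrm{CoCone}(\mathcal X,\mathcal Y)$, resp. $\mathcal X*\mathcal Y$) consist of the objects $B$ admitting a conflation $X\rightarrowtail Y\twoheadrightarrow B$ (resp. $B\rightarrowtail X\twoheadrightarrow Y$, resp. $X\rightarrowtail B\twoheadrightarrow Y$) with $X\in\mathcal X$, $Y\in\mathcal Y$.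 A cotorsion pair is a pair $(\mathcal U,\mathcal V)$ of additive subcategories closed under isomorphisms and direct summands such that $\mathbb E(\mathcal U,\mathcal V)=0$ and $\mathcal B=\mathrm{Cone}(\mathcal V,\mathcal U)=\mathrm{CoCone}(\mathcal V,\mathcal U)$. Let $(\mathcal U,\mathcal V)$ be a cotorsion pair on $\mathcal B$, and put $\mathcal W=\mathcal U\cap\mathcal V$, $\mathcal B^+=\mathrm{Cone}(\mathcal V,\mathcal W)$, $\mathcal B^-=\mathrm{CoCone}(\mathcal W,\mathcal U)$. The heart is $\underline{\mathcal H}=(\mathcal B^+\cap\mathcal B^-)/\mathcal W$, a full subcategory of $\mathcal B/\mathcal W$. The inclusion $\mathcal B^+/\mathcal W\hookrightarrow\mathcal B/\mathcal W$ has a left adjoint $\sigma^+$, the inclusion $\mathcal B^- /\mathcal W\hookrightarrow\mathcal B/\mathcal W$ has a right adjoint $\sigma^-$, and $H=\sigma^-\circ\sigma^+\circ\pi\colon\mathcal B\to\underline{\mathcal H}$, where $\pi\colon\mathcal B\to\mathcal B/\mathcal W$ is the quotient functor. Let $\mathcal K=\mathrm{add}(\mathcal U*\mathcal V)$ be the kernel,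 where $\mathrm{add}$ is the closure under direct summands, and let $\mathcal C={}^{\perp_1}\mathcal K=\{X\mid \mathbb E(X,\mathcal K)=0\}$ be the coheart. Let $\Omega\mathcal C=\mathrm{CoCone}(\mathcal P,\mathcal C)$, with $\mathcal P$ the subcategory of projectives of $\mathcal B$, and let $H(\Omega\mathcal C)\subseteq\underline{\mathcal H}$ be the essential image of $\Omega\mathcal C$ under $H$. Then the following are equivalent. (1) Every object $B\in\underline{\mathcal H}$ admits an epimorphism $X\to B$ in $\underline{\mathcal H}$ with $X\in H(\Omega\mathcal C)$. (2) $(\mathcal C,\mathcal K)$ is a cotorsion pair on $\mathcal B$. (3) $\mathcal B=\mathrm{CoCone}(\mathcal K,\mathcal C)$. (4) $\mathcal U\subseteq\mathrm{Cone}(\mathcal K,\mathcal C)$. Moreover, in this case $\underline{\mathcal H}$ has enough projectives, and the subcategory of projective objects of $\underline{\mathcal H}$ is $\mathrm{add}(H(\Omega\mathcal C))$, where $\mathrm{add}$ denotes the closure under direct summands in $\underline{\mathcal H}$. -/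

import Mathlib

open CategoryTheory CategoryTheory.Limits Opposite
open scoped ZeroObject

universe w v u

namespace Extri

section Sequences

variable {B : Type u} [Category.{v} B]

/-- A sequence `A ⟶ mid ⟶ C` of two morphisms with fixed ends. -/
structure Seq (A C : B) where
  mid : B
  i : A ⟶ mid
  p : mid ⟶ C

/-- Two sequences with the same ends are equivalent if there is an isomorphism between the middle
terms which commutes with the morphisms. -/
instance seqSetoid (A C : B) : Setoid (Seq A C) where
  r S S' := ∃ b : S.mid ≅ S'.mid, S.i ≫ b.hom = S'.i ∧ b.hom ≫ S'.p = S.p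
  iseqv :=
    { refl := fun S => ⟨Iso.refl _, by simp, by simp⟩
      symm := by
        rintro S S' ⟨b, h₁, h₂⟩
        exact ⟨b.symm, by simp [← h₁], by simp [← h₂]⟩
      trans := by
        rintro S S' S'' ⟨b, h₁, h₂⟩ ⟨b', h₁', h₂'⟩
        exact ⟨b ≪≫ b', by simp [← h₁', ← h₁], by simp [h₂', h₂]⟩ }

end Sequences

section Extriangulated

variable (B : Type u) [Category.{v} B]

/-- A bifunctor `E : Bᵒᵖ × B ⥤ Ab` together with a correspondence `s` which associates an
equivalence class of sequences `A ⟶ M ⟶ C` to every `δ ∈ E(C, A)`. -/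
structure PreExtriangulated where
  E : Bᵒᵖ ⥤ B ⥤ AddCommGrpCat.{w}
  s : ∀ {A C : B}, ((E.obj (op C)).obj A) → Quotient (seqSetoid A C)

namespace PreExtriangulated

variable {B} (T : PreExtriangulated.{w} B)

/-- The group `E(C, A)` of extensions. -/
abbrev Ext (C A : B) : Type w := (T.E.obj (op C)).obj A

/-- `δ ↦ a_* δ`. -/
def push {C A A' : B} (a : A ⟶ A') : T.Ext C A →+ T.Ext C A' := ((T.E.obj (op C)).map a).hom

/-- `δ ↦ c^* δ`. -/
def pull {C C' A : B} (c : C' ⟶ C) : T.Ext C A →+ T.Ext C' A := ((T.E.map c.op).app A).hom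

/-- The sequence `A ⟶ M ⟶ C` realizes `δ ∈ E(C, A)`. -/
def Realizes {A M C : B} (x : A ⟶ M) (y : M ⟶ C) (δ : T.Ext C A) : Prop :=
  T.s δ = Quotient.mk _ ⟨M, x, y⟩

/-- The extension `δ ⊕ δ' ∈ E(C ⊞ C', A ⊞ A')`, corresponding to the matrix `(δ, 0, 0, δ')`. -/
noncomputable def extSum [Preadditive B] [HasBinaryBiproducts B] {A C A' C' : B}
    (δ : T.Ext C A) (δ' : T.Ext C' A') : T.Ext (C ⊞ C') (A ⊞ A') :=
  T.push biprod.inl (T.pull biprod.fst δ) + T.push biprod.inr (T.pull biprod.snd δ')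

end PreExtriangulated

/-- An extriangulated structure `(E, s)` on the additive category `B`. -/
structure Extriangulated [Preadditive B] [HasZeroObject B] [HasBinaryBiproducts B] extends
    PreExtriangulated.{w} B where
  /-- additivity of `E` in the contravariant variable -/
  additive_left : E.Additive
  /-- additivity of `E` in the covariant variable -/
  additive_right : ∀ C : Bᵒᵖ, (E.obj C).Additive
  /-- morphisms of extensions can be realized -/
  realize_hom : ∀ {A M C A' M' C' : B} {x : A ⟶ M} {y : M ⟶ C} {x' : A' ⟶ M'} {y' : M' ⟶ C'}
    {δ : toPreExtriangulated.Ext C A} {δ' : toPreExtriangulated.Ext C' A'},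
    toPreExtriangulated.Realizes x y δ → toPreExtriangulated.Realizes x' y' δ' →
    ∀ (a : A ⟶ A') (c : C ⟶ C'),
      toPreExtriangulated.push a δ = toPreExtriangulated.pull c δ' →
      ∃ b : M ⟶ M', x ≫ b = a ≫ x' ∧ y ≫ c = b ≫ y'
  /-- the zero extension is realized by the split sequence -/
  realize_zero : ∀ A C : B, toPreExtriangulated.Realizes
    (biprod.inl : A ⟶ A ⊞ C) (biprod.snd : A ⊞ C ⟶ C) 0
  /-- the realization is compatible with direct sums -/
  realize_sum : ∀ {A M C A' M' C' : B} {x : A ⟶ M} {y : M ⟶ C} {x' : A' ⟶ M'} {y' : M' ⟶ C'}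
    {δ : toPreExtriangulated.Ext C A} {δ' : toPreExtriangulated.Ext C' A'},
    toPreExtriangulated.Realizes x y δ → toPreExtriangulated.Realizes x' y' δ' →
    toPreExtriangulated.Realizes (biprod.map x x') (biprod.map y y')
      (toPreExtriangulated.extSum δ δ')
  /-- (ET3) -/
  et3 : ∀ {A M C A' M' C' : B} {x : A ⟶ M} {y : M ⟶ C} {x' : A' ⟶ M'} {y' : M' ⟶ C'}
    {δ : toPreExtriangulated.Ext C A} {δ' : toPreExtriangulated.Ext C' A'},
    toPreExtriangulated.Realizes x y δ → toPreExtriangulated.Realizes x' y' δ' →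
    ∀ (a : A ⟶ A') (b : M ⟶ M'), x ≫ b = a ≫ x' →
      ∃ c : C ⟶ C', toPreExtriangulated.push a δ = toPreExtriangulated.pull c δ' ∧
        y ≫ c = b ≫ y'
  /-- (ET3)ᵒᵖ -/
  et3_op : ∀ {A M C A' M' C' : B} {x : A ⟶ M} {y : M ⟶ C} {x' : A' ⟶ M'} {y' : M' ⟶ C'}
    {δ : toPreExtriangulated.Ext C A} {δ' : toPreExtriangulated.Ext C' A'},
    toPreExtriangulated.Realizes x y δ → toPreExtriangulated.Realizes x' y' δ' →
    ∀ (b : M ⟶ M') (c : C ⟶ C'), y ≫ c = b ≫ y' →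
      ∃ a : A ⟶ A', toPreExtriangulated.push a δ = toPreExtriangulated.pull c δ' ∧
        x ≫ b = a ≫ x'
  /-- (ET4) -/
  et4 : ∀ {A M D C F : B} {f : A ⟶ M} {f' : M ⟶ D} {g : M ⟶ C} {g' : C ⟶ F}
    {δ : toPreExtriangulated.Ext D A} {δ' : toPreExtriangulated.Ext F M},
    toPreExtriangulated.Realizes f f' δ → toPreExtriangulated.Realizes g g' δ' →
    ∃ (X : B) (h' : C ⟶ X) (d : D ⟶ X) (e : X ⟶ F) (δ'' : toPreExtriangulated.Ext X A),
      f' ≫ d = g ≫ h' ∧ h' ≫ e = g' ∧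
      toPreExtriangulated.Realizes (f ≫ g) h' δ'' ∧
      toPreExtriangulated.Realizes d e (toPreExtriangulated.push f' δ') ∧
      toPreExtriangulated.pull d δ'' = δ ∧
      toPreExtriangulated.push f δ'' = toPreExtriangulated.pull e δ'
  /-- (ET4)ᵒᵖ -/
  et4_op : ∀ {D A M F C : B} {f' : D ⟶ A} {f : A ⟶ M} {g' : F ⟶ M} {g : M ⟶ C}
    {δ : toPreExtriangulated.Ext M D} {δ' : toPreExtriangulated.Ext C F},
    toPreExtriangulated.Realizes f' f δ → toPreExtriangulated.Realizes g' g δ' →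
    ∃ (X : B) (h' : X ⟶ A) (d : D ⟶ X) (e : X ⟶ F) (δ'' : toPreExtriangulated.Ext C X),
      d ≫ h' = f' ∧ e ≫ g' = h' ≫ f ∧
      toPreExtriangulated.Realizes h' (f ≫ g) δ'' ∧
      toPreExtriangulated.Realizes d e (toPreExtriangulated.pull g' δ) ∧
      toPreExtriangulated.push e δ'' = δ' ∧
      toPreExtriangulated.push d δ = toPreExtriangulated.pull g δ''

end Extriangulated

/-- `X` is a direct summand of `Y`, i.e. `Y ≅ X ⊕ X'` for some object `X'`. -/
def IsSummand {A : Type*} [Category* A] [HasZeroMorphisms A] (X Y : A) : Prop :=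
  ∃ (X' : A) (b : BinaryBicone X X'), Nonempty b.IsBilimit ∧ Nonempty (b.pt ≅ Y)

/-- The closure `add P` of a full subcategory under direct summands. -/
def addClosure {A : Type*} [Category* A] [HasZeroMorphisms A] (P : ObjectProperty A) :
    ObjectProperty A :=
  fun X => ∃ Y, P Y ∧ IsSummand X Y

variable {B : Type u} [Category.{v} B] [Preadditive B] [HasZeroObject B] [HasBinaryBiproducts B]

/-- A full additive subcategory closed under isomorphisms and direct summands. -/
structure IsAdditiveSummandClosed (P : ObjectProperty B) : Prop where
  zero : ∀ Z : B, IsZero Z → P Z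
  biprod : ∀ X Y : B, P X → P Y → P (X ⊞ Y)
  iso : ∀ X Y : B, Nonempty (X ≅ Y) → P Y → P X
  summand : ∀ X Y : B, IsSummand X Y → P Y → P X

namespace Extriangulated

variable (T : Extriangulated.{w} B)

/-- `A ⟶ M ⟶ C` is a conflation. -/
def Conflation {A M C : B} (x : A ⟶ M) (y : M ⟶ C) : Prop := ∃ δ : T.Ext C A, T.Realizes x y δ

/-- Projective objects: `E(P, -) = 0`. -/
def proj : ObjectProperty B := fun P => ∀ (A : B) (δ : T.Ext P A), δ = 0

/-- Every object is the target of a deflation from a projective object. -/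
def HasEnoughProj : Prop :=
  ∀ X : B, ∃ (K P : B) (k : K ⟶ P) (p : P ⟶ X), T.proj P ∧ T.Conflation k p

/-- `Cone(D₁, D₂)`: the objects `X` with a conflation `D₁ ⟶ D₂ ⟶ X`. -/
def cone (P Q : ObjectProperty B) : ObjectProperty B :=
  fun X => ∃ (D₁ D₂ : B) (x : D₁ ⟶ D₂) (y : D₂ ⟶ X), P D₁ ∧ Q D₂ ∧ T.Conflation x y

/-- `CoCone(D₁, D₂)`: the objects `X` with a conflation `X ⟶ D₁ ⟶ D₂`. -/
def cocone (P Q : ObjectProperty B) : ObjectProperty B :=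
  fun X => ∃ (D₁ D₂ : B) (x : X ⟶ D₁) (y : D₁ ⟶ D₂), P D₁ ∧ Q D₂ ∧ T.Conflation x y

/-- `D₁ * D₂`: the objects `X` with a conflation `D₁ ⟶ X ⟶ D₂`. -/
def star (P Q : ObjectProperty B) : ObjectProperty B :=
  fun X => ∃ (D₁ D₂ : B) (x : D₁ ⟶ X) (y : X ⟶ D₂), P D₁ ∧ Q D₂ ∧ T.Conflation x y

/-- `^{⊥₁}P`: the objects `X` with `E(X, P) = 0`. -/
def leftPerp (P : ObjectProperty B) : ObjectProperty B :=
  fun X => ∀ Y : B, P Y → ∀ δ : T.Ext X Y, δ = 0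

/-- `Ω P = CoCone(projectives, P)`. -/
def omega (P : ObjectProperty B) : ObjectProperty B := T.cocone T.proj P

/-- `(U, V)` is a (complete) cotorsion pair. -/
structure IsCotorsionPair (U V : ObjectProperty B) : Prop where
  left : IsAdditiveSummandClosed U
  right : IsAdditiveSummandClosed V
  ext_zero : ∀ X Y : B, U X → V Y → ∀ δ : T.Ext X Y, δ = 0
  /-- for every `X` there is a conflation `V_X ⟶ U_X ⟶ X` -/
  resolve : ∀ X : B, T.cone V U X
  /-- for every `X` there is a conflation `X ⟶ V^X ⟶ U^X` -/
  coresolve : ∀ X : B, T.cocone V U X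

section Exactness

variable {T}

lemma push_id {C A : B} (δ : T.Ext C A) : T.push (𝟙 A) δ = δ := by
  simp [PreExtriangulated.push]

lemma pull_id {C A : B} (δ : T.Ext C A) : T.pull (𝟙 C) δ = δ := by
  simp [PreExtriangulated.pull]

lemma push_comp {C A A' A'' : B} (a : A ⟶ A') (a' : A' ⟶ A'') (δ : T.Ext C A) :
    T.push (a ≫ a') δ = T.push a' (T.push a δ) := by
  simp [PreExtriangulated.push]

lemma pull_comp {C C' C'' A : B} (c : C' ⟶ C) (c' : C'' ⟶ C') (δ : T.Ext C A) :
    T.pull (c' ≫ c) δ = T.pull c' (T.pull c δ) := by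
  simp [PreExtriangulated.pull]

lemma push_pull {C C' A A' : B} (a : A ⟶ A') (c : C' ⟶ C) (δ : T.Ext C A) :
    T.push a (T.pull c δ) = T.pull c (T.push a δ) := by
  simp only [PreExtriangulated.push, PreExtriangulated.pull]
  exact congr($((T.E.map c.op).naturality a) δ).symm

lemma pull_sub {C C' A : B} (c d : C' ⟶ C) (δ : T.Ext C A) :
    T.pull (c - d) δ = T.pull c δ - T.pull d δ := by
  have := T.additive_left
  simp only [PreExtriangulated.pull, op_sub, Functor.map_sub]
  rfl

lemma push_sub {C A A' : B} (a b : A ⟶ A') (δ : T.Ext C A) :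
    T.push (a - b) δ = T.push a δ - T.push b δ := by
  have := T.additive_right (op C)
  simp only [PreExtriangulated.push, Functor.map_sub]
  rfl

lemma exists_realizes {A C : B} (δ : T.Ext C A) :
    ∃ (M : B) (x : A ⟶ M) (y : M ⟶ C), T.Realizes x y δ := by
  obtain ⟨⟨M, x, y⟩, h⟩ := Quotient.exists_rep (T.s δ)
  exact ⟨M, x, y, h.symm⟩

variable {A M C : B} {x : A ⟶ M} {y : M ⟶ C} {δ : T.Ext C A}

lemma comp_eq_zero (h : T.Realizes x y δ) : x ≫ y = 0 := by
  obtain ⟨c, -, hc⟩ := T.et3 (T.realize_zero A 0) h (𝟙 A) (biprod.fst ≫ x) (by simp)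
  have := congr(biprod.inl ≫ $hc)
  simpa using this.symm

lemma pull_eq_zero (h : T.Realizes x y δ) : T.pull y δ = 0 := by
  obtain ⟨a, ha, -⟩ := T.et3_op (T.realize_zero A M) h (biprod.desc x (𝟙 M)) y
    (by ext <;> simp [comp_eq_zero h])
  rw [← ha, map_zero]

lemma push_eq_zero (h : T.Realizes x y δ) : T.push x δ = 0 := by
  obtain ⟨c, hc, -⟩ := T.et3 h (T.realize_zero M C) x (biprod.lift (𝟙 M) y)
    (by ext <;> simp [comp_eq_zero h])
  rw [hc, map_zero]

lemma exists_desc (h : T.Realizes x y δ) {X : B} (f : M ⟶ X) (hf : x ≫ f = 0) :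
    ∃ g : C ⟶ X, y ≫ g = f := by
  obtain ⟨c, -, hc⟩ := T.et3 h (T.realize_zero 0 X) 0 (f ≫ biprod.inr)
    (by rw [← Category.assoc, hf]; simp)
  exact ⟨c, by simpa using hc⟩

lemma exists_lift (h : T.Realizes x y δ) {X : B} (f : X ⟶ M) (hf : f ≫ y = 0) :
    ∃ g : X ⟶ A, g ≫ x = f := by
  obtain ⟨a, -, ha⟩ := T.et3_op (T.realize_zero X 0) h (biprod.fst ≫ f) 0
    (by simp [hf])
  exact ⟨a, by simpa using ha.symm⟩

lemma exists_extend (h : T.Realizes x y δ) {X : B} (a : A ⟶ X) (ha : T.push a δ = 0) :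
    ∃ b : M ⟶ X, x ≫ b = a := by
  obtain ⟨b, hb, -⟩ := T.realize_hom h (T.realize_zero X C) a (𝟙 C) (by rw [ha, map_zero])
  exact ⟨b ≫ biprod.fst, by rw [← Category.assoc, hb]; simp⟩

lemma exists_colift (h : T.Realizes x y δ) {X : B} (c : X ⟶ C) (hc : T.pull c δ = 0) :
    ∃ b : X ⟶ M, b ≫ y = c := by
  obtain ⟨b, -, hb⟩ := T.realize_hom (T.realize_zero A X) h (𝟙 A) c (by rw [hc, map_zero])
  exact ⟨biprod.inr ≫ b, by rw [Category.assoc, ← hb]; simp⟩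

lemma exists_pull (h : T.Realizes x y δ) {X : B} (ε : T.Ext M X) (hε : T.pull x ε = 0) :
    ∃ θ : T.Ext C X, T.pull y θ = ε := by
  obtain ⟨N, i, p, hN⟩ := exists_realizes ε
  obtain ⟨Z, h', d, e, δ'', -, -, -, h₄, -, h₆⟩ := T.et4_op hN h
  obtain ⟨r, hr⟩ := exists_extend h₄ (𝟙 X) (by rw [push_id, hε])
  exact ⟨T.push r δ'', by rw [← push_pull, ← h₆, ← push_comp, hr, push_id]⟩

lemma exists_push (h : T.Realizes x y δ) {X : B} (ε : T.Ext X M) (hε : T.push y ε = 0) :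
    ∃ θ : T.Ext X A, T.push x θ = ε := by
  obtain ⟨N, i, p, hN⟩ := exists_realizes ε
  obtain ⟨Z, h', d, e, δ'', -, -, -, h₄, -, h₆⟩ := T.et4 h hN
  obtain ⟨r, hr⟩ := exists_colift h₄ (𝟙 X) (by rw [pull_id, hε])
  exact ⟨T.pull r δ'', by rw [push_pull, h₆, ← pull_comp, hr, pull_id]⟩

end Exactness

/-- A cotorsion pair `(U, V)` on `(B, E, s)`. -/
structure CotorsionPair where
  U : ObjectProperty B
  V : ObjectProperty B
  isCotorsionPair : T.IsCotorsionPair U V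

end Extriangulated

open Extriangulated

namespace Extriangulated.CotorsionPair

variable {T : Extriangulated.{w} B} (P : T.CotorsionPair)

/-- The core `W = U ∩ V`. -/
def core : ObjectProperty B := P.U ⊓ P.V

/-- `B⁺ = Cone(V, W)`. -/
def plus : ObjectProperty B := T.cone P.V P.core

/-- `B⁻ = CoCone(W, U)`. -/
def minus : ObjectProperty B := T.cocone P.core P.U

/-- The kernel `K = add (U * V)`. -/
def kernel : ObjectProperty B := addClosure (T.star P.U P.V)

/-- The coheart `C = ^{⊥₁}K`. -/
def coheart : ObjectProperty B := T.leftPerp P.kernel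

/-- Two morphisms are identified in `B/W` iff their difference factors through an object of `W`. -/
def rel : HomRel B := fun X Y f g =>
  ∃ (W : B) (a : X ⟶ W) (b : W ⟶ Y), P.core W ∧ f - g = a ≫ b

variable {P} in
lemma core_zero (Z : B) (hZ : IsZero Z) : P.core Z :=
  ⟨P.isCotorsionPair.left.zero _ hZ, P.isCotorsionPair.right.zero _ hZ⟩

variable {P} in
lemma core_biprod {X Y : B} (hX : P.core X) (hY : P.core Y) : P.core (X ⊞ Y) :=
  ⟨P.isCotorsionPair.left.biprod _ _ hX.1 hY.1, P.isCotorsionPair.right.biprod _ _ hX.2 hY.2⟩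

lemma rel_add {X Y : B} (f₁ f₂ g₁ g₂ : X ⟶ Y) (hf : P.rel f₁ f₂) (hg : P.rel g₁ g₂) :
    P.rel (f₁ + g₁) (f₂ + g₂) := by
  obtain ⟨W, a, b, hW, h⟩ := hf
  obtain ⟨W', a', b', hW', h'⟩ := hg
  refine ⟨W ⊞ W', biprod.lift a a', biprod.desc b b', core_biprod hW hW', ?_⟩
  rw [biprod.lift_desc, ← h, ← h']
  abel

instance : Congruence P.rel where
  comp_left := by
    rintro X Y Z f g g' ⟨W, a, b, hW, h⟩
    exact ⟨W, f ≫ a, b, hW, by rw [← Preadditive.comp_sub, h, Category.assoc]⟩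
  comp_right := by
    rintro X Y Z f f' g ⟨W, a, b, hW, h⟩
    exact ⟨W, a, b ≫ g, hW, by rw [← Preadditive.sub_comp, h, Category.assoc]⟩
  equivalence := by
    intro X Y
    have hrefl : ∀ f : X ⟶ Y, P.rel f f := fun f =>
      ⟨0, 0, 0, core_zero _ (isZero_zero B), by simp⟩
    have hsymm : ∀ {f g : X ⟶ Y}, P.rel f g → P.rel g f := by
      rintro f g ⟨W, a, b, hW, h⟩
      exact ⟨W, -a, b, hW, by rw [Preadditive.neg_comp, ← h, neg_sub]⟩
    refine ⟨hrefl, hsymm, ?_⟩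
    intro f g k hfg hgk
    have := P.rel_add _ _ _ _ (P.rel_add _ _ _ _ hfg hgk) (hrefl (-g))
    simpa using this

/-- The quotient category `B/W`. -/
abbrev Quot := CategoryTheory.Quotient P.rel

instance : Preadditive P.Quot := Quotient.preadditive P.rel (fun _ _ _ _ _ _ => P.rel_add _ _ _ _)

/-- The quotient functor `B ⥤ B/W`. -/
abbrev π : B ⥤ P.Quot := Quotient.functor P.rel

/-- `B⁺/W`, as a full subcategory of `B/W`. -/
def qPlus : ObjectProperty P.Quot := fun X => P.plus X.as

/-- `B⁻/W`, as a full subcategory of `B/W`. -/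
def qMinus : ObjectProperty P.Quot := fun X => P.minus X.as

/-- The objects of the heart: those of `B⁺ ∩ B⁻`. -/
def qHeart : ObjectProperty P.Quot := fun X => P.plus X.as ∧ P.minus X.as

/-- The heart `(B⁺ ∩ B⁻)/W`. -/
abbrev Heart := P.qHeart.FullSubcategory

section Existence

variable {P}

lemma ext_zero {X Y : B} (hX : P.U X) (hY : P.V Y) (δ : T.Ext X Y) : δ = 0 :=
  P.isCotorsionPair.ext_zero X Y hX hY δ

lemma iso_of_realizes_zero {A M C : B} {x : A ⟶ M} {y : M ⟶ C} (h : T.Realizes x y 0) :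
    Nonempty (M ≅ A ⊞ C) := by
  have h' := (T.realize_zero A C).symm.trans h
  obtain ⟨b, -⟩ := Quotient.exact h'
  exact ⟨b.symm⟩

lemma mem_U {X : B} (h : ∀ Y, P.V Y → ∀ δ : T.Ext X Y, δ = 0) : P.U X := by
  obtain ⟨V, U, v, u, hV, hU, δ, hδ⟩ := P.isCotorsionPair.resolve X
  obtain rfl := h _ hV δ
  obtain ⟨e⟩ := iso_of_realizes_zero hδ
  exact P.isCotorsionPair.left.summand X U
    ⟨V, BinaryBiproduct.bicone X V, ⟨BinaryBiproduct.isBilimit X V⟩,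
      ⟨biprod.braiding X V ≪≫ e.symm⟩⟩ hU

lemma mem_V {Y : B} (h : ∀ X, P.U X → ∀ δ : T.Ext X Y, δ = 0) : P.V Y := by
  obtain ⟨V, U, v, u, hV, hU, δ, hδ⟩ := P.isCotorsionPair.coresolve Y
  obtain rfl := h _ hU δ
  obtain ⟨e⟩ := iso_of_realizes_zero hδ
  exact P.isCotorsionPair.right.summand Y V
    ⟨U, BinaryBiproduct.bicone Y U, ⟨BinaryBiproduct.isBilimit Y U⟩, ⟨e.symm⟩⟩ hV

lemma plus_of_injective {X Y : B} (f : X ⟶ Y)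
    (hf : ∀ U, P.U U → ∀ ε : T.Ext U X, T.push f ε = 0 → ε = 0) (hY : P.plus Y) : P.plus X := by
  obtain ⟨V, W, v, k, hV, hW, lam, hlam⟩ := hY
  obtain ⟨VX, UX, vX, uX, hVX, hUX, δ, hδ⟩ := P.isCotorsionPair.resolve X
  refine ⟨VX, UX, vX, uX, hVX, ⟨hUX, mem_V fun Z hZ ε => ?_⟩, δ, hδ⟩
  obtain ⟨l, hl⟩ := exists_colift hlam (uX ≫ f) (ext_zero hUX hV _)
  have h₁ : T.push uX ε = 0 := hf Z hZ _ (by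
    rw [← push_comp, ← hl, push_comp, ext_zero hZ hW.2 (T.push l ε), map_zero])
  obtain ⟨θ, rfl⟩ := exists_push hδ ε h₁
  rw [ext_zero hZ hVX θ, map_zero]

/-- Every object has a reflection in `B⁺/W`. -/
lemma exists_reflection (X : B) : ∃ (Z : B) (p : X ⟶ Z), P.plus Z ∧
    ∀ Y, P.plus Y → (∀ f : X ⟶ Y, ∃ g : Z ⟶ Y, p ≫ g = f) ∧
      ∀ g : Z ⟶ Y, P.rel (p ≫ g) 0 → P.rel g 0 := by
  obtain ⟨V, U, v, u, hV, hU, δ, hδ⟩ := P.isCotorsionPair.resolve X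
  obtain ⟨W, S, i, q, hW, hS, μ, hμ⟩ := P.isCotorsionPair.coresolve U
  have hWU : P.U W := mem_U fun Y hY ε => by
    obtain ⟨θ, rfl⟩ := exists_pull hμ ε (ext_zero hU hY _)
    rw [ext_zero hS hY θ, map_zero]
  obtain ⟨Z, t, p, s, δ'', h₁, h₂, h₃, h₄, h₅, h₆⟩ := T.et4 hδ hμ
  refine ⟨Z, p, ⟨V, W, v ≫ i, t, hV, ⟨hWU, hW⟩, δ'', h₃⟩, ?_⟩
  rintro Y ⟨VY, WY, vY, wY, hVY, hWY, lam, hlam⟩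
  have ext (a : X ⟶ WY) : ∃ b : Z ⟶ WY, p ≫ b = a :=
    exists_extend h₄ a (ext_zero hS hWY.2 _)
  have fac (g : Z ⟶ Y) (W₀ : B) (hW₀ : P.core W₀) (a : X ⟶ W₀) (b : W₀ ⟶ Y)
      (hab : p ≫ g = a ≫ b) : P.rel g 0 := by
    obtain ⟨a', ha'⟩ := exists_extend h₄ a (ext_zero hS hW₀.2 _)
    obtain ⟨c, hc⟩ := exists_desc h₄ (g - a' ≫ b)
      (by rw [Preadditive.comp_sub, ← Category.assoc, ha', hab, sub_self])
    obtain ⟨k, hk⟩ := exists_colift hlam c (ext_zero hS hVY _)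
    refine ⟨W₀ ⊞ WY, biprod.lift a' (s ≫ k), biprod.desc b wY, core_biprod hW₀ hWY, ?_⟩
    rw [biprod.lift_desc, Category.assoc, hk, hc]
    abel
  refine ⟨fun f => ?_, ?_⟩
  · obtain ⟨k, hk⟩ := exists_colift hlam (u ≫ f) (ext_zero hU hVY _)
    obtain ⟨k', hk'⟩ := exists_extend hμ k (ext_zero hS hWY.2 _)
    obtain ⟨g, hg, hg'⟩ := T.et3_op hδ hlam k f hk.symm
    obtain ⟨c, hc, hc'⟩ := T.et3 h₃ hlam g k' (by rw [Category.assoc, hk', hg'])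
    have h₀ : T.pull (f - p ≫ c) lam = 0 := by
      rw [pull_sub, pull_comp, ← hc, ← push_pull, h₅, hg, sub_self]
    obtain ⟨l, hl⟩ := exists_colift hlam _ h₀
    obtain ⟨l', hl'⟩ := ext l
    exact ⟨c + l' ≫ wY, by rw [Preadditive.comp_add, ← Category.assoc, hl', hl]; abel⟩
  · rintro g ⟨W₀, a, b, hW₀, h⟩
    exact fac g W₀ hW₀ a b (by simpa using h)

/-- Every object has a coreflection in `B⁻/W`. -/
lemma exists_coreflection (X : B) : ∃ (Z : B) (m : Z ⟶ X), P.minus Z ∧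
    (∀ U, P.U U → ∀ ε : T.Ext U Z, T.push m ε = 0 → ε = 0) ∧
    ∀ Y, P.minus Y → (∀ f : Y ⟶ X, ∃ g : Y ⟶ Z, g ≫ m = f) ∧
      ∀ g : Y ⟶ Z, P.rel (g ≫ m) 0 → P.rel g 0 := by
  obtain ⟨V, U, v, u, hV, hU, δ, hδ⟩ := P.isCotorsionPair.coresolve X
  obtain ⟨V', W, j, q, hV', hW, μ, hμ⟩ := P.isCotorsionPair.resolve V
  have hWV : P.V W := mem_V fun Y hY ε => by
    obtain ⟨θ, rfl⟩ := exists_push hμ ε (ext_zero hY hV _)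
    rw [ext_zero hY hV' θ, map_zero]
  obtain ⟨Z, t, d, m, δ'', h₁, h₂, h₃, h₄, h₅, h₆⟩ := T.et4_op hμ hδ
  refine ⟨Z, m, ⟨W, U, t, q ≫ u, ⟨hW, hWV⟩, hU, δ'', h₃⟩, fun U' hU' ε hε => ?_, ?_⟩
  · obtain ⟨θ, rfl⟩ := exists_push h₄ ε hε
    rw [ext_zero hU' hV' θ, map_zero]
  rintro Y ⟨WY, UY, wY, uY, hWY, hUY, lam, hlam⟩
  refine ⟨fun f => ?_, ?_⟩
  · obtain ⟨k, hk⟩ := exists_extend hlam (f ≫ v) (ext_zero hUY hV _)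
    obtain ⟨k', hk'⟩ := exists_colift hμ k (ext_zero hWY.1 hV' _)
    obtain ⟨g, hg, hg'⟩ := T.et3 hlam hδ f k hk
    obtain ⟨c, hc, hc'⟩ := T.et3_op hlam h₃ k' g (by rw [← Category.assoc, hk', hg'])
    have h₀ : T.push (f - c ≫ m) lam = 0 := by
      rw [push_sub, push_comp, hc, push_pull, h₅, hg, sub_self]
    obtain ⟨l, hl⟩ := exists_extend hlam _ h₀
    obtain ⟨l', hl'⟩ := exists_colift h₄ l (ext_zero hWY.1 hV' _)
    exact ⟨c + wY ≫ l', by rw [Preadditive.add_comp, Category.assoc, hl', hl]; abel⟩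
  · rintro g ⟨W₀, a, b, hW₀, h⟩
    obtain ⟨b', hb'⟩ := exists_colift h₄ b (ext_zero hW₀.1 hV' _)
    obtain ⟨c, hc⟩ := exists_lift h₄ (g - a ≫ b')
      (by rw [Preadditive.sub_comp, Category.assoc, hb', ← h, sub_zero, sub_self])
    obtain ⟨k, hk⟩ := exists_extend hlam c (ext_zero hUY hV' _)
    refine ⟨W₀ ⊞ WY, biprod.lift a wY, biprod.desc b' (k ≫ d), core_biprod hW₀ hWY, ?_⟩
    rw [biprod.lift_desc, ← Category.assoc wY, hk, hc]
    abel

lemma map_eq_iff {X Y : B} (f g : X ⟶ Y) : P.π.map f = P.π.map g ↔ P.rel f g :=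
  Quotient.functor_map_eq_iff P.rel f g

lemma rel_sub {X Y : B} {f g : X ⟶ Y} : P.rel f g ↔ P.rel (f - g) 0 := by
  simp only [rel, sub_zero]

/-- `B⁺` is closed under isomorphisms in `B/W`. -/
lemma plus_of_iso {X Y : P.Quot} (e : X ≅ Y) (hY : P.plus Y.as) : P.plus X.as := by
  obtain ⟨f, hf⟩ := P.π.map_surjective (X := X.as) (Y := Y.as) e.hom
  obtain ⟨g, hg⟩ := P.π.map_surjective (X := Y.as) (Y := X.as) e.inv
  have h : P.π.map (𝟙 X.as) = P.π.map (f ≫ g) := by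
    rw [Functor.map_comp, hf, hg, CategoryTheory.Functor.map_id]
    exact e.hom_inv_id.symm
  obtain ⟨W, a, b, hW, hab⟩ := (map_eq_iff _ _).1 h
  refine plus_of_injective f (fun U hU ε hε => ?_) hY
  have : T.push (𝟙 X.as - f ≫ g) ε = 0 := by
    rw [hab, push_comp, ext_zero hU hW.2 (T.push a ε), map_zero]
  rwa [push_sub, push_id, push_comp, hε, map_zero, sub_zero] at this

end Existence

instance : P.qPlus.ι.IsRightAdjoint := by
  have : ∀ X : P.Quot, HasInitial (StructuredArrow X P.qPlus.ι) := by
    rintro ⟨X⟩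
    obtain ⟨Z, p, hZ, h⟩ := P.exists_reflection X
    let Z' : P.qPlus.FullSubcategory := ⟨P.π.obj Z, hZ⟩
    refine IsInitial.hasInitial (X := StructuredArrow.mk (Y := Z') (P.π.map p))
      (IsInitial.ofUniqueHom (fun Y => ?_) ?_)
    · refine StructuredArrow.homMk (ObjectProperty.homMk (P.π.map
        ((h Y.right.obj.as Y.right.property).1
          (P.π.map_surjective (X := X) (Y := Y.right.obj.as) Y.hom).choose).choose)) ?_
      have h₁ := (P.π.map_surjective (X := X) (Y := Y.right.obj.as) Y.hom).choose_spec
      have h₂ := ((h Y.right.obj.as Y.right.property).1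
          (P.π.map_surjective (X := X) (Y := Y.right.obj.as) Y.hom).choose).choose_spec
      exact ((P.π.map_comp _ _).symm.trans (congrArg P.π.map h₂)).trans h₁
    · intro Y
      suffices ∀ m m' : StructuredArrow.mk (Y := Z') (P.π.map p) ⟶ Y, m = m' from
        fun m => this _ _
      intro m m'
      apply StructuredArrow.ext
      apply ObjectProperty.hom_ext
      obtain ⟨g, hg⟩ := P.π.map_surjective (X := Z) (Y := Y.right.obj.as) m.right.hom
      obtain ⟨g', hg'⟩ := P.π.map_surjective (X := Z) (Y := Y.right.obj.as) m'.right.hom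
      have e₁ : P.π.map (p ≫ g) = Y.hom :=
        ((P.π.map_comp _ _).trans (congrArg (P.π.map p ≫ ·) hg)).trans (StructuredArrow.w m)
      have e₂ : P.π.map (p ≫ g') = Y.hom :=
        ((P.π.map_comp _ _).trans (congrArg (P.π.map p ≫ ·) hg')).trans (StructuredArrow.w m')
      have e₃ := rel_sub.1 ((map_eq_iff _ _).1 (e₁.trans e₂.symm))
      rw [← Preadditive.comp_sub] at e₃
      have e₄ := rel_sub.2 ((h Y.right.obj.as Y.right.property).2 _ e₃)
      exact hg.symm.trans (((map_eq_iff _ _).2 e₄).trans hg')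
  exact isRightAdjointOfStructuredArrowInitials _

/-- The morphism in `B⁻/W` which is a coreflection of `X`. -/
lemma exists_isTerminal (X : B) : ∃ (Z : B) (m : Z ⟶ X) (hZ : P.minus Z),
    (∀ U, P.U U → ∀ ε : T.Ext U Z, T.push m ε = 0 → ε = 0) ∧
    Nonempty (IsTerminal (CostructuredArrow.mk (S := P.qMinus.ι)
      (Y := (⟨P.π.obj Z, hZ⟩ : P.qMinus.FullSubcategory)) (P.π.map m))) := by
  obtain ⟨Z, p, hZ, hinj, h⟩ := P.exists_coreflection X
  let Z' : P.qMinus.FullSubcategory := ⟨P.π.obj Z, hZ⟩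
  refine ⟨Z, p, hZ, hinj, ⟨IsTerminal.ofUniqueHom (fun Y => ?_) ?_⟩⟩
  · refine CostructuredArrow.homMk (ObjectProperty.homMk (P.π.map
      ((h Y.left.obj.as Y.left.property).1
        (P.π.map_surjective (X := Y.left.obj.as) (Y := X) Y.hom).choose).choose)) ?_
    have h₁ := (P.π.map_surjective (X := Y.left.obj.as) (Y := X) Y.hom).choose_spec
    have h₂ := ((h Y.left.obj.as Y.left.property).1
        (P.π.map_surjective (X := Y.left.obj.as) (Y := X) Y.hom).choose).choose_spec
    exact ((P.π.map_comp _ _).symm.trans (congrArg P.π.map h₂)).trans h₁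
  · intro Y
    suffices ∀ m m' : Y ⟶ CostructuredArrow.mk (S := P.qMinus.ι) (Y := Z') (P.π.map p),
      m = m' from fun m => this _ _
    intro m m'
    apply CostructuredArrow.ext
    apply ObjectProperty.hom_ext
    obtain ⟨g, hg⟩ := P.π.map_surjective (X := Y.left.obj.as) (Y := Z) m.left.hom
    obtain ⟨g', hg'⟩ := P.π.map_surjective (X := Y.left.obj.as) (Y := Z) m'.left.hom
    have e₁ : P.π.map (g ≫ p) = Y.hom :=
      ((P.π.map_comp _ _).trans (congrArg (· ≫ P.π.map p) hg)).trans (CostructuredArrow.w m)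
    have e₂ : P.π.map (g' ≫ p) = Y.hom :=
      ((P.π.map_comp _ _).trans (congrArg (· ≫ P.π.map p) hg')).trans (CostructuredArrow.w m')
    have e₃ := rel_sub.1 ((map_eq_iff _ _).1 (e₁.trans e₂.symm))
    rw [← Preadditive.sub_comp] at e₃
    have e₄ := rel_sub.2 ((h Y.left.obj.as Y.left.property).2 _ e₃)
    exact hg.symm.trans (((map_eq_iff _ _).2 e₄).trans hg')

instance : P.qMinus.ι.IsLeftAdjoint := by
  have : ∀ X : P.Quot, HasTerminal (CostructuredArrow P.qMinus.ι X) := by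
    rintro ⟨X⟩
    obtain ⟨Z, m, hZ, -, ⟨h⟩⟩ := P.exists_isTerminal X
    exact h.hasTerminal
  exact isLeftAdjoint_of_costructuredArrowTerminals _

/-- `σ⁺ : B/W ⥤ B⁺/W`, the left adjoint (reflection) of the inclusion. -/
noncomputable def sigmaPlus : P.Quot ⥤ P.qPlus.FullSubcategory := P.qPlus.ι.leftAdjoint

/-- `σ⁻ : B/W ⥤ B⁻/W`, the right adjoint (coreflection) of the inclusion. -/
noncomputable def sigmaMinus : P.Quot ⥤ P.qMinus.FullSubcategory := P.qMinus.ι.rightAdjoint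

/-- `σ⁻` sends objects of `B⁺` into the heart. -/
lemma sigmaMinus_mem (X : P.Quot) (hX : P.plus X.as) : P.qHeart (P.sigmaMinus.obj X).obj := by
  refine ⟨?_, (P.sigmaMinus.obj X).property⟩
  obtain ⟨Z, m, hZ, hinj, ⟨h⟩⟩ := P.exists_isTerminal X.as
  have h' := mkTerminalOfRightAdjoint _ (Adjunction.ofIsLeftAdjoint P.qMinus.ι) X
  let e := h'.uniqueUpToIso h
  exact plus_of_iso (P.qMinus.ι.mapIso ((CostructuredArrow.proj _ _).mapIso e))
    (plus_of_injective m hinj hX)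

/-- The functor `H = σ⁻ ∘ σ⁺ ∘ π : B ⥤ Heart`. -/
noncomputable def H : B ⥤ P.Heart :=
  P.qHeart.lift (P.π ⋙ P.sigmaPlus ⋙ P.qPlus.ι ⋙ P.sigmaMinus ⋙ P.qMinus.ι)
    fun X => P.sigmaMinus_mem _ (P.sigmaPlus.obj (P.π.obj X)).property

/-- `H(Ω C)`: the essential image under `H` of the objects in `Ω C`, where `C` is the coheart. -/
def HOmegaCoheart : ObjectProperty P.Heart :=
  fun Y => ∃ X : B, T.omega P.coheart X ∧ Nonempty (P.H.obj X ≅ Y)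

end Extriangulated.CotorsionPair

end Extri

/-! Everything rests on what vanishes modulo the core `W`. A morphism from `B⁻` to `B⁺` that factors
through the kernel is zero in `B/W` (`rel_zero_of_kernel`), and so is any morphism from `U` to `B⁺`
(`rel_zero_of_U`). Let `X → D → C` be a conflation with `D` projective and `C` in the coheart. Since
`E(C, K) = 0` for `K` in the kernel, every map from `X` to `K` extends to `D`; since `D` lies in
`U`, maps through `D` into `B⁺` vanish. On `B⁻`, which contains `X`, the functor `H` is just the
reflection into `B⁺` (`nonempty_iso_H`), so the heart can be computed with morphisms of `B`.

An epimorphism of the heart has its relative cone in `U` (`U_of_epi`), so the obstruction to lifting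
a map from `X` lies in `E(C, U) = 0`; hence `H(X)` is projective (`projective_of_omega`).

If `Y → K → C` is a conflation with `Y` in the heart, covering `C` by a projective gives a map `X →
Y`. A morphism out of `Y` killed by it extends over `K` and therefore vanishes, so (3) gives (1).
Conversely, let `A` be a syzygy of an object of `U`. An epimorphism from `H(X)` onto `H(A)` comes,
up to a map through `D`, from some `a : X → A`. Pushing `X → D → C` out along `a` gives `A → Q → C`,
and the epimorphism forces `Q` into `U`. A pushout then gives (4) (`cone_of_cocone`), a pullback
gives (3) (`cocone_of_cone`), and the same pushout gives (2).

Finally, a projective of the heart splits off any `H(X)` that maps onto it. -/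

namespace Extri

open Extriangulated

/-! ### Criteria for isomorphisms. -/

section IsoCriteria

variable {A : Type*} [Category* A]

lemma isIso_of_isIso_comp_comp {X Y : A} (f : X ⟶ Y) (g : Y ⟶ X) [IsIso (f ≫ g)]
    [IsIso (g ≫ f)] : IsIso f := by
  have h₁ : f ≫ g ≫ inv (f ≫ g) = 𝟙 X := by rw [← Category.assoc, IsIso.hom_inv_id]
  have h₂ : inv (g ≫ f) ≫ g ≫ f = 𝟙 Y := IsIso.inv_hom_id _
  have h₃ : g ≫ inv (f ≫ g) = inv (g ≫ f) ≫ g := by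
    calc g ≫ inv (f ≫ g) = (inv (g ≫ f) ≫ g ≫ f) ≫ g ≫ inv (f ≫ g) := by
          rw [h₂, Category.id_comp]
      _ = inv (g ≫ f) ≫ g ≫ (f ≫ g ≫ inv (f ≫ g)) := by simp only [Category.assoc]
      _ = _ := by rw [h₁, Category.comp_id]
  exact ⟨g ≫ inv (f ≫ g), h₁, by rw [h₃, Category.assoc, h₂]⟩

/-- If `f = 1 + n` with `n² = 0`, the inverse is `1 - n = 2 - f`. Comparison maps between
conflations are inverse to each other only up to such an error. -/
lemma isIso_of_sub_id_sq_eq_zero [Preadditive A] {X : A} (f : X ⟶ X)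
    (h : (f - 𝟙 X) ≫ (f - 𝟙 X) = 0) : IsIso f := by
  have h' : f ≫ f = f + f - 𝟙 X := by
    simp only [Preadditive.comp_sub, Preadditive.sub_comp, Category.comp_id,
      Category.id_comp] at h
    rw [← sub_eq_zero, ← h]
    abel
  refine ⟨𝟙 X + 𝟙 X - f, ?_, ?_⟩ <;>
  · simp only [Preadditive.comp_sub, Preadditive.sub_comp, Preadditive.comp_add,
      Preadditive.add_comp, Category.comp_id, Category.id_comp, h']
    abel

end IsoCriteria

variable {B : Type u} [Category.{v} B] [Preadditive B] [HasZeroObject B] [HasBinaryBiproducts B]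

/-! ### Conflations: invariance, uniqueness, pushouts and pullbacks. -/

namespace Extriangulated

variable {T : Extriangulated.{w} B}

lemma realizes_of_iso {A M M' C : B} {x : A ⟶ M} {y : M ⟶ C} {δ : T.Ext C A}
    (h : T.Realizes x y δ) {x' : A ⟶ M'} {y' : M' ⟶ C} (b : M ≅ M') (hx : x ≫ b.hom = x')
    (hy : b.hom ≫ y' = y) : T.Realizes x' y' δ :=
  Eq.trans h (Quotient.sound ⟨b, hx, hy⟩)

lemma realizes_id (A Z : B) (hZ : IsZero Z) : T.Realizes (𝟙 A) (0 : A ⟶ Z) 0 :=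
  realizes_of_iso (T.realize_zero A Z)
    ⟨biprod.fst, biprod.inl, by ext <;> simp [hZ.eq_of_src biprod.inr 0], by simp⟩ (by simp)
    (hZ.eq_of_tgt _ _)

lemma realizes_zero_id (Z C : B) (hZ : IsZero Z) : T.Realizes (0 : Z ⟶ C) (𝟙 C) 0 :=
  realizes_of_iso (T.realize_zero Z C)
    ⟨biprod.snd, biprod.inr, by ext <;> simp [hZ.eq_of_src biprod.inl 0], by simp⟩ (by simp)
    (by simp)

/-- Precomposing `b ≫ b' - 𝟙` with `x` gives zero, so it factors through `y`; postcomposing it with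
`y` also gives zero, so its square vanishes. The other composite is symmetric. -/
lemma isIso_of_realizes {A A' M M' C C' : B} {x : A ⟶ M} {y : M ⟶ C} {δ : T.Ext C A}
    (h : T.Realizes x y δ) {x' : A' ⟶ M'} {y' : M' ⟶ C'} {δ' : T.Ext C' A'}
    (h' : T.Realizes x' y' δ') (a : A ≅ A') (c : C ≅ C') {b : M ⟶ M'} {b' : M' ⟶ M}
    (hx : x ≫ b = a.hom ≫ x') (hy : y ≫ c.hom = b ≫ y')
    (hx' : x' ≫ b' = a.inv ≫ x) (hy' : y' ≫ c.inv = b' ≫ y) : IsIso b := by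
  have : IsIso (b ≫ b') := by
    apply isIso_of_sub_id_sq_eq_zero
    obtain ⟨g, hg⟩ := exists_desc h (b ≫ b' - 𝟙 M) (by
      rw [Preadditive.comp_sub, reassoc_of% hx, hx']; simp)
    nth_rw 2 [← hg]
    rw [← Category.assoc, Preadditive.sub_comp, Category.assoc, ← hy', ← reassoc_of% hy]
    simp
  have : IsIso (b' ≫ b) := by
    apply isIso_of_sub_id_sq_eq_zero
    obtain ⟨g, hg⟩ := exists_desc h' (b' ≫ b - 𝟙 M') (by
      rw [Preadditive.comp_sub, reassoc_of% hx', hx]; simp)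
    nth_rw 2 [← hg]
    rw [← Category.assoc, Preadditive.sub_comp, Category.assoc, ← hy, ← reassoc_of% hy']
    simp
  exact isIso_of_isIso_comp_comp b b'

/-- Invariance under isomorphisms of the end terms is not an axiom: the given sequence is compared
with some realization of the transported extension. -/
lemma realizes_pull_iso {A M C C' : B} {x : A ⟶ M} {y : M ⟶ C} {δ : T.Ext C A}
    (h : T.Realizes x y δ) (c : C ≅ C') : T.Realizes x (y ≫ c.hom) (T.pull c.inv δ) := by
  obtain ⟨M', x', y', h'⟩ := exists_realizes (T.pull c.inv δ)
  obtain ⟨b, hx, hy⟩ := T.realize_hom h h' (𝟙 A) c.hom (by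
    rw [push_id, ← pull_comp, c.hom_inv_id, pull_id])
  obtain ⟨b', hx', hy'⟩ := T.realize_hom h' h (𝟙 A) c.inv (by rw [push_id])
  have := isIso_of_realizes h h' (Iso.refl A) c hx hy hx' hy'
  exact realizes_of_iso h' (asIso b).symm (by simpa using hx.symm) (by simp [hy])

lemma realizes_push_iso {A A' M C : B} {x : A ⟶ M} {y : M ⟶ C} {δ : T.Ext C A}
    (h : T.Realizes x y δ) (a : A ≅ A') : T.Realizes (a.inv ≫ x) y (T.push a.hom δ) := by
  obtain ⟨M', x', y', h'⟩ := exists_realizes (T.push a.hom δ)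
  obtain ⟨b, hx, hy⟩ := T.realize_hom h h' a.hom (𝟙 C) (by rw [pull_id])
  obtain ⟨b', hx', hy'⟩ := T.realize_hom h' h a.inv (𝟙 C) (by
    rw [pull_id, ← push_comp, a.hom_inv_id, push_id])
  have := isIso_of_realizes h h' a (Iso.refl C) hx hy hx' hy'
  exact realizes_of_iso h' (asIso b).symm (by simp [hx]) (by simpa using hy)

/-- The cone of an inflation is unique up to isomorphism. -/
lemma exists_iso_cone {A M C C' : B} {x : A ⟶ M} {y : M ⟶ C} {δ : T.Ext C A} {y' : M ⟶ C'}
    {δ' : T.Ext C' A} (h : T.Realizes x y δ) (h' : T.Realizes x y' δ') :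
    ∃ c : C ≅ C', y ≫ c.hom = y' := by
  obtain ⟨c, hc, hy⟩ := T.et3 h h' (𝟙 A) (𝟙 M) (by simp)
  obtain ⟨c', hc', hy'⟩ := T.et3 h' h (𝟙 A) (𝟙 M) (by simp)
  rw [push_id] at hc hc'
  rw [Category.id_comp] at hy hy'
  have : IsIso (c ≫ c') := by
    apply isIso_of_sub_id_sq_eq_zero
    -- The error `c ≫ c' - 𝟙` pulls `δ` back to zero, so it lifts through `y`; it also vanishes
    -- after `y`, so its square is zero.
    obtain ⟨t, ht⟩ := exists_colift h (c ≫ c' - 𝟙 C) (by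
      rw [pull_sub, pull_comp, pull_id, ← hc', ← hc, sub_self])
    nth_rw 1 [← ht]
    rw [Category.assoc, Preadditive.comp_sub, reassoc_of% hy, hy']
    simp
  have : IsIso (c' ≫ c) := by
    apply isIso_of_sub_id_sq_eq_zero
    obtain ⟨t, ht⟩ := exists_colift h' (c' ≫ c - 𝟙 C') (by
      rw [pull_sub, pull_comp, pull_id, ← hc, ← hc', sub_self])
    nth_rw 1 [← ht]
    rw [Category.assoc, Preadditive.comp_sub, reassoc_of% hy', hy]
    simp
  have := isIso_of_isIso_comp_comp c c'
  exact ⟨asIso c, hy⟩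

/-- The cocone of a deflation is unique up to isomorphism. -/
lemma exists_iso_cocone {A A' M C : B} {x : A ⟶ M} {y : M ⟶ C} {δ : T.Ext C A} {x' : A' ⟶ M}
    {δ' : T.Ext C A'} (h : T.Realizes x y δ) (h' : T.Realizes x' y δ') :
    ∃ a : A ≅ A', a.hom ≫ x' = x := by
  obtain ⟨a, ha, hx⟩ := T.et3_op h h' (𝟙 M) (𝟙 C) (by simp)
  obtain ⟨a', ha', hx'⟩ := T.et3_op h' h (𝟙 M) (𝟙 C) (by simp)
  rw [pull_id] at ha ha'
  rw [Category.comp_id] at hx hx'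
  have : IsIso (a ≫ a') := by
    apply isIso_of_sub_id_sq_eq_zero
    obtain ⟨t, ht⟩ := exists_extend h (a ≫ a' - 𝟙 A) (by
      rw [push_sub, push_comp, push_id, ha, ha', sub_self])
    nth_rw 2 [← ht]
    rw [← Category.assoc, Preadditive.sub_comp, Category.assoc, ← hx', ← hx]
    simp
  have : IsIso (a' ≫ a) := by
    apply isIso_of_sub_id_sq_eq_zero
    obtain ⟨t, ht⟩ := exists_extend h' (a' ≫ a - 𝟙 A') (by
      rw [push_sub, push_comp, push_id, ha', ha, sub_self])
    nth_rw 2 [← ht]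
    rw [← Category.assoc, Preadditive.sub_comp, Category.assoc, ← hx, ← hx']
    simp
  have := isIso_of_isIso_comp_comp a a'
  exact ⟨asIso a, hx.symm⟩

/-- The pushout of a conflation along a morphism out of its first term, together with its mapping
cone conflation. -/
lemma exists_pushout {A A' M C : B} {x : A ⟶ M} {y : M ⟶ C} {δ : T.Ext C A}
    (h : T.Realizes x y δ) (a : A ⟶ A') :
    ∃ (X : B) (x' : A' ⟶ X) (y' : X ⟶ C) (b : M ⟶ X) (θ : T.Ext X A),
      T.Realizes x' y' (T.push a δ) ∧ b ≫ y' = y ∧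
      T.Realizes (biprod.lift x (-a)) (biprod.desc b x') θ := by
  -- The split inflation `(1, -a)` followed by `x ⊕ 𝟙` is `(x, -a)`. (ET4) for this composite yields
  -- both conflations at once.
  have h₁ : T.Realizes (biprod.lift (𝟙 A) (-a)) (biprod.desc a (𝟙 A')) 0 :=
    realizes_of_iso (T.realize_zero A A')
      ⟨biprod.desc (biprod.lift (𝟙 A) (-a)) biprod.inr,
        biprod.desc (biprod.lift (𝟙 A) a) biprod.inr, by ext <;> simp, by ext <;> simp⟩
      (by simp) (by ext <;> simp)
  have h₂ := realizes_pull_iso (T.realize_sum h (realizes_id (T := T) A' 0 (isZero_zero B)))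
    (c := ⟨biprod.fst, biprod.inl, by ext <;> simp, by simp⟩)
  obtain ⟨X, h', d, e, δ'', e₁, e₂, e₃, e₄, -, -⟩ := T.et4 h₁ h₂
  have e₅ : biprod.inr ≫ h' = d := by simpa using congr(biprod.inr ≫ $e₁).symm
  have e₆ : biprod.desc (biprod.inl ≫ h') d = h' := by rw [← e₅]; ext <;> simp
  refine ⟨X, d, e, biprod.inl ≫ h', δ'', ?_, by simp [e₂], ?_⟩
  · convert e₄ using 1
    simp only [PreExtriangulated.extSum, map_zero, add_zero]
    rw [← push_pull, ← pull_comp, biprod.inl_fst, pull_id, ← push_comp, biprod.inl_desc]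
  · rw [e₆]
    convert e₃ using 1
    ext <;> simp

/-- The pullback of a conflation along a morphism into its last term, together with its mapping
cocone conflation. -/
lemma exists_pullback {A M C C' : B} {x : A ⟶ M} {y : M ⟶ C} {δ : T.Ext C A}
    (h : T.Realizes x y δ) (c : C' ⟶ C) :
    ∃ (X : B) (x' : A ⟶ X) (y' : X ⟶ C') (b : X ⟶ M) (θ : T.Ext C X),
      T.Realizes x' y' (T.pull c δ) ∧ x' ≫ b = x ∧
      T.Realizes (biprod.lift b y') (biprod.desc y (-c)) θ := by
  have h₁ : T.Realizes (biprod.lift c (𝟙 C')) (biprod.desc (𝟙 C) (-c)) 0 :=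
    realizes_of_iso (T.realize_zero C' C)
      ⟨biprod.desc (biprod.lift c (𝟙 C')) biprod.inl,
        biprod.lift biprod.snd (biprod.fst - biprod.snd ≫ c), by ext <;> simp, by ext <;> simp⟩
      (by simp) (by ext <;> simp)
  have h₂ := realizes_push_iso (T.realize_sum h (realizes_zero_id (T := T) 0 C' (isZero_zero B)))
    (a := ⟨biprod.fst, biprod.inl, by ext <;> simp, by simp⟩)
  obtain ⟨X, h', d, e, δ'', e₁, e₂, e₃, e₄, -, -⟩ := T.et4_op h₂ h₁
  have e₅ : h' ≫ biprod.snd = e := by simpa using congr($e₂ ≫ biprod.snd).symm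
  have e₆ : biprod.lift (h' ≫ biprod.fst) e = h' := by rw [← e₅]; ext <;> simp
  refine ⟨X, d, e, h' ≫ biprod.fst, δ'', ?_, by simp [reassoc_of% e₁], ?_⟩
  · convert e₄ using 1
    simp only [PreExtriangulated.extSum, map_zero, add_zero]
    rw [← push_comp, biprod.inl_fst, push_id, ← pull_comp, biprod.lift_fst]
  · rw [e₆]
    convert e₃ using 1
    ext <;> simp

/-- Two conflations with the same first term fit into a common pushout. -/
lemma exists_common_pushout {A M C M' C' : B} {x : A ⟶ M} {y : M ⟶ C} {x' : A ⟶ M'}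
    {y' : M' ⟶ C'} (h : T.Conflation x y) (h' : T.Conflation x' y') :
    ∃ (N : B) (m : M ⟶ N) (n : N ⟶ C') (m' : M' ⟶ N) (n' : N ⟶ C),
      T.Conflation m n ∧ T.Conflation m' n' := by
  obtain ⟨δ, h⟩ := h
  obtain ⟨δ', h'⟩ := h'
  obtain ⟨X, i, p, b, θ, h₁, -, h₂⟩ := exists_pushout h x'
  obtain ⟨X', i', p', b', θ', h₁', -, h₂'⟩ := exists_pushout h' x
  -- Swapping the summands with signs carries `(x', -x)` to `(x, -x')`, so both mapping cones have
  -- the same inflation and hence isomorphic last terms.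
  have h₃ : T.Realizes (biprod.lift x (-x')) (biprod.lift (-biprod.snd) (-biprod.fst) ≫
      biprod.desc b' i') θ' :=
    realizes_of_iso h₂' ⟨biprod.lift (-biprod.snd) (-biprod.fst),
      biprod.lift (-biprod.snd) (-biprod.fst), by ext <;> simp, by ext <;> simp⟩
      (by ext <;> simp) (by ext <;> simp)
  obtain ⟨c, -⟩ := exists_iso_cone h₂ h₃
  exact ⟨X, i' ≫ c.inv, c.hom ≫ p', i, p,
    ⟨_, realizes_of_iso h₁' c.symm rfl (by simp)⟩, ⟨_, h₁⟩⟩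

/-- Two conflations with the same last term fit into a common pullback. -/
lemma exists_common_pullback {A M C A' M' : B} {x : A ⟶ M} {y : M ⟶ C} {x' : A' ⟶ M'}
    {y' : M' ⟶ C} (h : T.Conflation x y) (h' : T.Conflation x' y') :
    ∃ (N : B) (m : A ⟶ N) (n : N ⟶ M') (m' : A' ⟶ N) (n' : N ⟶ M),
      T.Conflation m n ∧ T.Conflation m' n' := by
  obtain ⟨δ, h⟩ := h
  obtain ⟨δ', h'⟩ := h'
  obtain ⟨X, i, p, b, θ, h₁, -, h₂⟩ := exists_pullback h y'
  obtain ⟨X', i', p', b', θ', h₁', -, h₂'⟩ := exists_pullback h' y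
  have h₃ : T.Realizes (biprod.lift b' p' ≫ biprod.lift (-biprod.snd) (-biprod.fst))
      (biprod.desc y (-y')) θ' :=
    realizes_of_iso h₂' ⟨biprod.lift (-biprod.snd) (-biprod.fst),
      biprod.lift (-biprod.snd) (-biprod.fst), by ext <;> simp, by ext <;> simp⟩
      rfl (by ext <;> simp)
  obtain ⟨a, -⟩ := exists_iso_cocone h₂ h₃
  exact ⟨X, i, p, i' ≫ a.inv, a.hom ≫ p', ⟨_, h₁⟩,
    ⟨_, realizes_of_iso h₁' a.symm rfl (by simp)⟩⟩

end Extriangulated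

end Extri
namespace Extri

open Extriangulated

/-! ### Direct summands. -/

section Summands

variable {A : Type*} [Category* A] [Preadditive A]

lemma isSummand_iff {X Y : A} : IsSummand X Y ↔ ∃ (X' : A) (i : X ⟶ Y) (r : Y ⟶ X)
    (i' : X' ⟶ Y) (r' : Y ⟶ X'), i ≫ r = 𝟙 X ∧ i' ≫ r' = 𝟙 X' ∧ i ≫ r' = 0 ∧ i' ≫ r = 0 ∧
      r ≫ i + r' ≫ i' = 𝟙 Y := by
  constructor
  · rintro ⟨X', b, ⟨hb⟩, ⟨e⟩⟩
    refine ⟨X', b.inl ≫ e.hom, e.inv ≫ b.fst, b.inr ≫ e.hom, e.inv ≫ b.snd, by simp, by simp,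
      by simp, by simp, ?_⟩
    have := IsBilimit.binary_total hb
    simpa using congr(e.inv ≫ $this ≫ e.hom)
  · rintro ⟨X', i, r, i', r', h₁, h₂, h₃, h₄, h₅⟩
    exact ⟨X', ⟨Y, r, r', i, i', h₁, h₃, h₄, h₂⟩, ⟨isBinaryBilimitOfTotal _ h₅⟩, ⟨Iso.refl Y⟩⟩

lemma IsSummand.refl [HasZeroObject A] (X : A) : IsSummand X X :=
  isSummand_iff.2 ⟨0, 𝟙 X, 𝟙 X, 0, 0, by simp, (isZero_zero A).eq_of_src _ _, by simp, by simp,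
    by simp⟩

lemma IsSummand.of_iso [HasZeroObject A] {X Y : A} (e : X ≅ Y) : IsSummand X Y :=
  isSummand_iff.2 ⟨0, e.hom, e.inv, 0, 0, by simp, (isZero_zero A).eq_of_src _ _, by simp,
    by simp, by simp⟩

lemma IsSummand.trans [HasBinaryBiproducts A] {X Y Z : A} (h : IsSummand X Y)
    (h' : IsSummand Y Z) : IsSummand X Z := by
  obtain ⟨X', i, r, i', r', h₁, h₂, h₃, h₄, h₅⟩ := isSummand_iff.1 h
  obtain ⟨Y', j, s, j', s', k₁, k₂, k₃, k₄, k₅⟩ := isSummand_iff.1 h'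
  refine isSummand_iff.2 ⟨X' ⊞ Y', i ≫ j, s ≫ r, biprod.desc (i' ≫ j) j',
    biprod.lift (s ≫ r') s', ?_, ?_, ?_, ?_, ?_⟩
  · simp [reassoc_of% k₁, h₁]
  · ext <;> simp [reassoc_of% k₁, reassoc_of% k₄, h₂, k₃, k₂]
  · ext <;> simp [reassoc_of% k₁, h₃, k₃]
  · ext <;> simp [reassoc_of% k₁, reassoc_of% k₄, h₄]
  · simp only [biprod.lift_desc, Category.assoc]
    rw [← add_assoc, ← Preadditive.comp_add, ← Category.assoc r, ← Category.assoc r',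
      ← Preadditive.add_comp, h₅, Category.id_comp, k₅]

lemma IsSummand.biprod [HasBinaryBiproducts A] {X Y X' Y' : A} (h : IsSummand X Y)
    (h' : IsSummand X' Y') : IsSummand (X ⊞ X') (Y ⊞ Y') := by
  obtain ⟨Z, i, r, i', r', h₁, h₂, h₃, h₄, h₅⟩ := isSummand_iff.1 h
  obtain ⟨Z', j, s, j', s', k₁, k₂, k₃, k₄, k₅⟩ := isSummand_iff.1 h'
  refine isSummand_iff.2 ⟨Z ⊞ Z', biprod.map i j, biprod.map r s, biprod.map i' j',
    biprod.map r' s', ?_, ?_, ?_, ?_, ?_⟩ <;> ext <;> simp [*]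

lemma IsSummand.exists_iso_biprod [HasBinaryBiproducts A] {X Y : A} (h : IsSummand X Y) :
    ∃ X' : A, Nonempty (X ⊞ X' ≅ Y) := by
  obtain ⟨Z, i, r, i', r', h₁, h₂, h₃, h₄, h₅⟩ := isSummand_iff.1 h
  exact ⟨Z, ⟨⟨biprod.desc i i', biprod.lift r r', by ext <;> simp [*], by simp [*]⟩⟩⟩

lemma isSummand_biprod_left [HasBinaryBiproducts A] (X Y : A) : IsSummand X (X ⊞ Y) :=
  ⟨Y, BinaryBiproduct.bicone X Y, ⟨BinaryBiproduct.isBilimit X Y⟩, ⟨Iso.refl _⟩⟩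

end Summands

variable {B : Type u} [Category.{v} B] [Preadditive B] [HasZeroObject B] [HasBinaryBiproducts B]

lemma isAdditiveSummandClosed_addClosure {Q : ObjectProperty B} (zero : ∃ Z, IsZero Z ∧ Q Z)
    (biprod : ∀ X Y, Q X → Q Y → Q (X ⊞ Y)) : IsAdditiveSummandClosed (addClosure Q) where
  zero Z hZ := by
    obtain ⟨Z', hZ', h⟩ := zero
    exact ⟨Z', h, .of_iso (hZ.iso hZ')⟩
  biprod := by
    rintro X X' ⟨Y, hY, h⟩ ⟨Y', hY', h'⟩
    exact ⟨_, biprod _ _ hY hY', h.biprod h'⟩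
  iso := by
    rintro X X' ⟨e⟩ ⟨Y, hY, h⟩
    exact ⟨Y, hY, (IsSummand.of_iso e).trans h⟩
  summand := by
    rintro X X' h ⟨Y, hY, h'⟩
    exact ⟨Y, hY, h.trans h'⟩

namespace Extriangulated

variable {T : Extriangulated.{w} B}

lemma pull_zero {C C' A : B} (δ : T.Ext C A) : T.pull (0 : C' ⟶ C) δ = 0 := by
  simpa using pull_sub (0 : C' ⟶ C) 0 δ

lemma star_biprod {Q R : ObjectProperty B} (hQ : ∀ X Y, Q X → Q Y → Q (X ⊞ Y))
    (hR : ∀ X Y, R X → R Y → R (X ⊞ Y)) (X Y : B) (hX : T.star Q R X) (hY : T.star Q R Y) :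
    T.star Q R (X ⊞ Y) := by
  obtain ⟨D₁, D₂, x, y, h₁, h₂, _, h⟩ := hX
  obtain ⟨D₁', D₂', x', y', h₁', h₂', _, h'⟩ := hY
  exact ⟨_, _, _, _, hQ _ _ h₁ h₁', hR _ _ h₂ h₂', _, T.realize_sum h h'⟩

lemma star_iso {Q R : ObjectProperty B} {X Y : B} (e : X ≅ Y) (hX : T.star Q R X) :
    T.star Q R Y := by
  obtain ⟨D₁, D₂, x, y, h₁, h₂, δ, h⟩ := hX
  exact ⟨D₁, D₂, x ≫ e.hom, e.inv ≫ y, h₁, h₂, δ, realizes_of_iso h e rfl (by simp)⟩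

lemma leftPerp_of_retract {Q : ObjectProperty B} {X Y : B} (i : X ⟶ Y) (r : Y ⟶ X)
    (h : i ≫ r = 𝟙 X) (hY : T.leftPerp Q Y) : T.leftPerp Q X := fun Z hZ δ => by
  rw [← pull_id δ, ← h, pull_comp, hY Z hZ (T.pull r δ), map_zero]

lemma leftPerp_of_conflation {Q : ObjectProperty B} {A M C : B} {x : A ⟶ M} {y : M ⟶ C}
    (h : T.Conflation x y) (hA : T.leftPerp Q A) (hC : T.leftPerp Q C) : T.leftPerp Q M :=
  fun Z hZ ε => by
    obtain ⟨δ, h⟩ := h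
    obtain ⟨θ, rfl⟩ := exists_pull h ε (hA Z hZ _)
    rw [hC Z hZ θ, map_zero]

lemma isAdditiveSummandClosed_leftPerp (Q : ObjectProperty B) :
    IsAdditiveSummandClosed (T.leftPerp Q) where
  zero Z hZ Y _ δ := by rw [← pull_id δ, hZ.eq_of_src (𝟙 Z) 0, pull_zero]
  biprod X Y hX hY := leftPerp_of_conflation ⟨_, T.realize_zero X Y⟩ hX hY
  iso := by
    rintro X Y ⟨e⟩ hY
    exact leftPerp_of_retract e.hom e.inv (by simp) hY
  summand := by
    rintro X Y h hY
    obtain ⟨X', i, r, -, -, h₁, -⟩ := isSummand_iff.1 h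
    exact leftPerp_of_retract i r h₁ hY

lemma leftPerp_of_proj {Q : ObjectProperty B} {X : B} (hX : T.proj X) : T.leftPerp Q X :=
  fun Y _ δ => hX Y δ

/-- If the syzygies of `X` embed into objects of `K` with cone in `^{⊥₁}Q`, then `X` is a quotient
of an object of `^{⊥₁}Q` by an object of `K`. -/
lemma cone_of_cocone {Q K : ObjectProperty B} (hT : T.HasEnoughProj) {X : B}
    (h : ∀ {A P : B} {k : A ⟶ P} {p : P ⟶ X}, T.proj P → T.Conflation k p →
      T.cocone K (T.leftPerp Q) A) : T.cone K (T.leftPerp Q) X := by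
  obtain ⟨A, P, k, p, hP, hp⟩ := hT X
  obtain ⟨D, C, x, y, hD, hC, hx⟩ := h hP hp
  obtain ⟨N, m, n, m', n', hm, hm'⟩ := exists_common_pushout hx hp
  -- `N` lies in `^{⊥₁}Q` because of the conflation `P → N → C`.
  exact ⟨D, N, m, n, hD, leftPerp_of_conflation hm' (leftPerp_of_proj hP) hC, hm⟩

end Extriangulated

/-! ### The kernel and the coheart of a cotorsion pair. -/

namespace Extriangulated.CotorsionPair

variable {T : Extriangulated.{w} B} {P : T.CotorsionPair}

lemma U_of_conflation {A M C : B} {x : A ⟶ M} {y : M ⟶ C} (h : T.Conflation x y) (hA : P.U A)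
    (hC : P.U C) : P.U M :=
  mem_U (leftPerp_of_conflation h (fun _ h _ => ext_zero hA h _) fun _ h _ => ext_zero hC h _)

lemma V_of_conflation {A M C : B} {x : A ⟶ M} {y : M ⟶ C} (h : T.Conflation x y) (hA : P.V A)
    (hC : P.V C) : P.V M := mem_V fun Z hZ ε => by
  obtain ⟨δ, h⟩ := h
  obtain ⟨θ, rfl⟩ := exists_push h ε (ext_zero hZ hC _)
  rw [ext_zero hZ hA θ, map_zero]

lemma kernel_of_U {X : B} (hX : P.U X) : P.kernel X :=
  ⟨X, ⟨X, 0, 𝟙 X, 0, hX, P.isCotorsionPair.right.zero _ (isZero_zero B), 0,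
    realizes_id X 0 (isZero_zero B)⟩, .refl X⟩

lemma kernel_of_V {X : B} (hX : P.V X) : P.kernel X :=
  ⟨X, ⟨0, X, 0, 𝟙 X, P.isCotorsionPair.left.zero _ (isZero_zero B), hX, 0,
    realizes_zero_id 0 X (isZero_zero B)⟩, .refl X⟩

lemma U_of_coheart {X : B} (hX : P.coheart X) : P.U X :=
  mem_U fun Y hY => hX Y (kernel_of_V hY)

lemma U_of_proj {X : B} (hX : T.proj X) : P.U X := mem_U fun Y _ => hX Y

lemma isAdditiveSummandClosed_kernel : IsAdditiveSummandClosed P.kernel :=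
  isAdditiveSummandClosed_addClosure
    ⟨0, isZero_zero B, 0, 0, 𝟙 0, 0, P.isCotorsionPair.left.zero _ (isZero_zero B),
      P.isCotorsionPair.right.zero _ (isZero_zero B), 0, realizes_id 0 0 (isZero_zero B)⟩
    (star_biprod P.isCotorsionPair.left.biprod P.isCotorsionPair.right.biprod)

/-- Adding a complement `K₂` of `K` reaches an honest object of `U * V`. (ET4) then regroups `(U *
V) * V` as `U * (V * V)`, and `V` is closed under extensions. -/
lemma kernel_of_conflation {K M V : B} {x : K ⟶ M} {y : M ⟶ V} (h : T.Conflation x y)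
    (hK : P.kernel K) (hV : P.V V) : P.kernel M := by
  obtain ⟨δ, h⟩ := h
  obtain ⟨K', hK', hKK'⟩ := hK
  obtain ⟨K₂, ⟨e⟩⟩ := hKK'.exists_iso_biprod
  obtain ⟨U, V', u, v, hU, hV', ε, hε⟩ := star_iso e.symm hK'
  have h' := T.realize_sum h (realizes_id (T := T) K₂ 0 (isZero_zero B))
  obtain ⟨X, k, d, c, θ, -, -, h₃, h₄, -, -⟩ := T.et4 hε h'
  exact ⟨M ⊞ K₂, ⟨U, X, _, k, hU, V_of_conflation ⟨_, h₄⟩ hV'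
    (P.isCotorsionPair.right.biprod _ _ hV (P.isCotorsionPair.right.zero _ (isZero_zero B))),
    _, h₃⟩, isSummand_biprod_left M K₂⟩

lemma isCotorsionPair_coheart_kernel (hT : T.HasEnoughProj)
    (h : ∀ X : B, T.cocone P.kernel P.coheart X) : T.IsCotorsionPair P.coheart P.kernel where
  left := isAdditiveSummandClosed_leftPerp _
  right := isAdditiveSummandClosed_kernel
  ext_zero X Y hX hY := hX Y hY
  resolve X := cone_of_cocone hT fun _ _ => h _
  coresolve := h

/-- Pulling `X → V → U` back along the deflation `C → U` replaces the last term by `C`. The new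
middle term `N` sits in `K → N → V`, so it stays in the kernel. -/
lemma cocone_of_cone (h : ∀ X : B, P.U X → T.cone P.kernel P.coheart X) (X : B) :
    T.cocone P.kernel P.coheart X := by
  obtain ⟨V, U, v, u, hV, hU, hX⟩ := P.isCotorsionPair.coresolve X
  obtain ⟨K, C, k, c, hK, hC, hU'⟩ := h U hU
  obtain ⟨N, m, n, m', n', hm, hm'⟩ := exists_common_pullback hX hU'
  exact ⟨N, C, m, n, kernel_of_conflation hm' hK hV, hC, hm⟩

/-! ### Morphisms modulo the core -/

lemma rel_zero_iff {X Y : B} {f : X ⟶ Y} :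
    P.rel f 0 ↔ ∃ (W : B) (a : X ⟶ W) (b : W ⟶ Y), P.core W ∧ f = a ≫ b := by
  simp only [rel, sub_zero]

lemma rel_zero_comp_right {X Y Z : B} {f : X ⟶ Y} (hf : P.rel f 0) (g : Y ⟶ Z) :
    P.rel (f ≫ g) 0 := by
  obtain ⟨W, a, b, hW, rfl⟩ := rel_zero_iff.1 hf
  exact rel_zero_iff.2 ⟨W, a, b ≫ g, hW, by simp⟩

lemma rel_zero_comp_left {X Y Z : B} {f : X ⟶ Y} (hf : P.rel f 0) (g : Z ⟶ X) :
    P.rel (g ≫ f) 0 := by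
  obtain ⟨W, a, b, hW, rfl⟩ := rel_zero_iff.1 hf
  exact rel_zero_iff.2 ⟨W, g ≫ a, b, hW, by simp⟩

lemma rel_zero_add {X Y : B} {f g : X ⟶ Y} (hf : P.rel f 0) (hg : P.rel g 0) :
    P.rel (f + g) 0 := by simpa using P.rel_add _ _ _ _ hf hg

lemma rel_zero_neg {X Y : B} {f : X ⟶ Y} (hf : P.rel f 0) : P.rel (-f) 0 := by
  obtain ⟨W, a, b, hW, rfl⟩ := rel_zero_iff.1 hf
  exact rel_zero_iff.2 ⟨W, -a, b, hW, by simp⟩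

/-- The obstruction to lifting `f` along the deflation `W → Y` lies in `E(U, V) = 0`. -/
lemma rel_zero_of_U {X Y : B} (f : X ⟶ Y) (hX : P.U X) (hY : P.plus Y) : P.rel f 0 := by
  obtain ⟨V, W, v, k, hV, hW, lam, h⟩ := hY
  obtain ⟨b, hb⟩ := exists_colift h f (ext_zero hX hV _)
  exact rel_zero_iff.2 ⟨W, b, k, hW, hb.symm⟩

lemma rel_zero_of_V {X Y : B} (f : X ⟶ Y) (hX : P.minus X) (hY : P.V Y) : P.rel f 0 := by
  obtain ⟨W, U, k, u, hW, hU, lam, h⟩ := hX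
  obtain ⟨b, hb⟩ := exists_extend h f (ext_zero hU hY _)
  exact rel_zero_iff.2 ⟨W, k, b, hW, hb.symm⟩

/-- Morphisms from `B⁻` to `B⁺` vanish in `B/W` if they factor through the kernel. -/
lemma rel_zero_of_kernel {X K Y : B} (f : X ⟶ K) (g : K ⟶ Y) (hX : P.minus X) (hK : P.kernel K)
    (hY : P.plus Y) : P.rel (f ≫ g) 0 := by
  obtain ⟨K', ⟨U, V, u, v, hU, hV, δ, h⟩, hK'⟩ := hK
  obtain ⟨-, i, r, -, -, hir, -⟩ := isSummand_iff.1 hK'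
  suffices h' : P.rel ((f ≫ i) ≫ (r ≫ g)) 0 by simpa [reassoc_of% hir] using h'
  generalize f ≫ i = f
  generalize r ≫ g = g
  obtain ⟨W₀, a, b, hW₀, hab⟩ := rel_zero_iff.1 (rel_zero_of_U (u ≫ g) hU hY)
  -- The pushout `Z` is an extension of `V` by `W₀`, hence in `V`, and `g` factors through it. Maps
  -- from `B⁻` to `V` vanish modulo the core.
  obtain ⟨Z, x', y', c, θ, h₁, -, h₂⟩ := exists_pushout h a
  obtain ⟨t, ht⟩ := exists_desc h₂ (biprod.desc g b) (by simp [hab])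
  have hcg : c ≫ t = g := by simpa using congr(biprod.inl ≫ $ht)
  rw [← hcg, ← Category.assoc]
  exact rel_zero_comp_right (rel_zero_of_V _ hX (V_of_conflation ⟨_, h₁⟩ hW₀.2 hV)) _

/-- In the coresolution `Y → V → U`, the map `f ≫ v` extends to an object of `U`, which kills `E(V,
-)` after pulling back to `X`. Injectivity of `f^*` and `E(U, -) = 0` on `V` then place the middle
term in `U`. Taking `f = 𝟙` gives `CoCone(U, U) = B⁻`. -/
lemma minus_of_injective {X Y : B} (f : X ⟶ Y)
    (hf : ∀ V, P.V V → ∀ ε : T.Ext Y V, T.pull f ε = 0 → ε = 0) (hX : T.cocone P.U P.U X) :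
    P.minus Y := by
  obtain ⟨U₁, U₂, x, y, hU₁, hU₂, lam, hlam⟩ := hX
  obtain ⟨V, U, v, u, hV, hU, δ, hδ⟩ := P.isCotorsionPair.coresolve Y
  refine ⟨V, U, v, u, ⟨mem_U fun Z hZ ε => ?_, hV⟩, hU, δ, hδ⟩
  obtain ⟨l, hl⟩ := exists_extend hlam (f ≫ v) (ext_zero hU₂ hV _)
  have h₁ : T.pull v ε = 0 := hf Z hZ _ (by
    rw [← pull_comp, ← hl, pull_comp, ext_zero hU₁ hZ (T.pull l ε), map_zero])
  obtain ⟨θ, rfl⟩ := exists_pull hδ ε h₁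
  rw [ext_zero hU hZ θ, map_zero]

lemma minus_of_cocone {X : B} (hX : T.cocone P.U P.U X) : P.minus X :=
  minus_of_injective (𝟙 X) (fun V _ ε h => by rwa [pull_id] at h) hX

lemma cocone_of_minus {X : B} (hX : P.minus X) : T.cocone P.U P.U X := by
  obtain ⟨W, U, x, y, hW, hU, h⟩ := hX
  exact ⟨W, U, x, y, hW.1, hU, h⟩

lemma minus_of_omega {X : B} (hX : T.omega P.coheart X) : P.minus X := by
  obtain ⟨W, U, x, y, hW, hU, h⟩ := hX
  exact minus_of_cocone ⟨W, U, x, y, U_of_proj hW, U_of_coheart hU, h⟩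

lemma minus_of_conflation {X Y U : B} {x : X ⟶ Y} {y : Y ⟶ U} (h : T.Conflation x y)
    (hX : P.minus X) (hU : P.U U) : P.minus Y :=
  minus_of_injective x (fun V hV ε hε => by
    obtain ⟨δ, h⟩ := h
    obtain ⟨θ, rfl⟩ := exists_pull h ε hε
    rw [ext_zero hU hV θ, map_zero]) (cocone_of_minus hX)

end Extriangulated.CotorsionPair

end Extri
namespace Extri.Extriangulated.CotorsionPair

lemma projective_of_retract {C : Type*} [Category* C] {X Y : C} (i : X ⟶ Y) (r : Y ⟶ X)
    (h : i ≫ r = 𝟙 X) (hY : Projective Y) : Projective X where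
  factors f e _ := ⟨i ≫ Projective.factorThru (r ≫ f) e, by
    rw [Category.assoc, Projective.factorThru_comp, reassoc_of% h]⟩

/-! ### Values of adjoints on objects. -/

section Adjunctions

variable {C D : Type*} [Category* C] [Category* D]

lemma nonempty_leftAdjoint_obj_iso {L : C ⥤ D} {R : D ⥤ C} (adj : L ⊣ R) {X : C} {Z : D}
    (p : X ⟶ R.obj Z) (hp : ∀ (Y : D) (f : X ⟶ R.obj Y), ∃ g : Z ⟶ Y, p ≫ R.map g = f)
    (hp' : ∀ (Y : D) (g g' : Z ⟶ Y), p ≫ R.map g = p ≫ R.map g' → g = g') :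
    Nonempty (L.obj X ≅ Z) := by
  obtain ⟨g, hg⟩ := hp _ (adj.unit.app X)
  have h := (adj.homEquiv X Z).apply_symm_apply p
  rw [adj.homEquiv_unit] at h
  refine ⟨(adj.homEquiv X Z).symm p, g, ?_, hp' _ _ _ ?_⟩
  · apply (adj.homEquiv _ _).injective
    rw [adj.homEquiv_unit, adj.homEquiv_unit, Functor.map_comp, reassoc_of% h, hg]
    simp
  · rw [Functor.map_comp, reassoc_of% hg, h]
    simp

lemma nonempty_rightAdjoint_obj_iso {L : C ⥤ D} {R : D ⥤ C} (adj : L ⊣ R) [L.Full] [L.Faithful]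
    (X : C) : Nonempty (R.obj (L.obj X) ≅ X) :=
  ⟨(asIso (adj.unit.app X)).symm⟩

end Adjunctions

variable {B : Type u} [Category.{v} B] [Preadditive B] [HasZeroObject B] [HasBinaryBiproducts B]
  {T : Extriangulated.{w} B} {P : T.CotorsionPair}

/-! ### Reflections into `B⁺`. -/

lemma rel_zero_of_conflation {X Z S Y : B} {p : X ⟶ Z} {s : Z ⟶ S} (h : T.Conflation p s)
    (hS : P.U S) (hY : P.plus Y) (g : Z ⟶ Y) (hg : P.rel (p ≫ g) 0) : P.rel g 0 := by
  obtain ⟨δ, h⟩ := h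
  obtain ⟨W, a, b, hW, hab⟩ := rel_zero_iff.1 hg
  obtain ⟨a', ha'⟩ := exists_extend h a (ext_zero hS hW.2 _)
  -- Minus a map through the core, `g` factors through `S`, and maps from `U` to `B⁺` vanish.
  obtain ⟨c, hc⟩ := exists_desc h (g - a' ≫ b)
    (by rw [Preadditive.comp_sub, reassoc_of% ha', hab, sub_self])
  have : g = s ≫ c + a' ≫ b := by rw [hc]; abel
  rw [this]
  exact rel_zero_add (rel_zero_comp_left (rel_zero_of_U c hS hY) s)
    (rel_zero_iff.2 ⟨W, a', b, hW, rfl⟩)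

/-- `p : X ⟶ Z` is a reflection of `X` in `B⁺/W` which is an inflation with cone in `U`. -/
structure IsReflection (P : T.CotorsionPair) {X Z : B} (p : X ⟶ Z) : Prop where
  plus : P.plus Z
  lift : ∀ Y, P.plus Y → ∀ f : X ⟶ Y, ∃ g : Z ⟶ Y, p ≫ g = f
  conflation : ∃ (S : B) (s : Z ⟶ S), P.U S ∧ T.Conflation p s
  mem_U : P.rel p 0 → P.U X

lemma IsReflection.rel_zero {X Z : B} {p : X ⟶ Z} (hp : P.IsReflection p) {Y : B}
    (hY : P.plus Y) {g : Z ⟶ Y} (hg : P.rel (p ≫ g) 0) : P.rel g 0 := by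
  obtain ⟨S, s, hS, h⟩ := hp.conflation
  exact rel_zero_of_conflation h hS hY g hg

lemma IsReflection.minus {X Z : B} {p : X ⟶ Z} (hp : P.IsReflection p) (hX : P.minus X) :
    P.minus Z := by
  obtain ⟨S, s, hS, h⟩ := hp.conflation
  exact minus_of_conflation h hX hS

/-- (ET4) applied to `V → U → X` and `U → W → S` gives `V → W → Z` and `X → Z → S`. The cone `S` and
the extension of `Z` are retained, as they give the last two fields. -/
lemma exists_isReflection (P : T.CotorsionPair) (X : B) :
    ∃ (Z : B) (p : X ⟶ Z), P.IsReflection p := by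
  obtain ⟨V, U, v, u, hV, hU, δ, hδ⟩ := P.isCotorsionPair.resolve X
  obtain ⟨W, S, i, q, hW, hS, μ, hμ⟩ := P.isCotorsionPair.coresolve U
  have hWU : P.U W := U_of_conflation ⟨_, hμ⟩ hU hS
  obtain ⟨Z, t, p, s, δ'', h₁, h₂, h₃, h₄, h₅, h₆⟩ := T.et4 hδ hμ
  refine ⟨Z, p, ⟨V, W, v ≫ i, t, hV, ⟨hWU, hW⟩, δ'', h₃⟩, ?_, ⟨S, s, hS, _, h₄⟩, fun hp => ?_⟩
  · rintro Y ⟨VY, WY, vY, wY, hVY, hWY, lam, hlam⟩ f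
    obtain ⟨k, hk⟩ := exists_colift hlam (u ≫ f) (ext_zero hU hVY _)
    obtain ⟨k', hk'⟩ := exists_extend hμ k (ext_zero hS hWY.2 _)
    obtain ⟨g, hg, hg'⟩ := T.et3_op hδ hlam k f hk.symm
    obtain ⟨c, hc, hc'⟩ := T.et3 h₃ hlam g k' (by rw [Category.assoc, hk', hg'])
    -- `f` and `p ≫ c` pull `lam` back to the same extension, so their difference lifts to `WY` and
    -- can be absorbed into `c`.
    have h₀ : T.pull (f - p ≫ c) lam = 0 := by
      rw [pull_sub, pull_comp, ← hc, ← push_pull, h₅, hg, sub_self]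
    obtain ⟨l, hl⟩ := exists_colift hlam _ h₀
    obtain ⟨l', hl'⟩ := exists_extend h₄ l (ext_zero hS hWY.2 _)
    exact ⟨c + l' ≫ wY, by rw [Preadditive.comp_add, ← Category.assoc, hl', hl]; abel⟩
  -- Since `δ = p^* δ''`, a factorization of `p` through the core sends it through `E(W₀, V) = 0`.
  -- So `δ` splits and `X` is a summand of `U`.
  · obtain ⟨W₀, a, b, hW₀, rfl⟩ := rel_zero_iff.1 hp
    have : δ = 0 := by
      rw [← h₅, pull_comp, ext_zero hW₀.1 hV (T.pull b δ''), map_zero]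
    subst this
    obtain ⟨e⟩ := iso_of_realizes_zero hδ
    exact P.isCotorsionPair.left.summand X U
      ⟨V, BinaryBiproduct.bicone X V, ⟨BinaryBiproduct.isBilimit X V⟩,
        ⟨biprod.braiding X V ≪≫ e.symm⟩⟩ hU

/-! ### The heart -/

instance : P.π.Additive := Quotient.functor_additive P.rel (fun _ _ _ _ _ _ => P.rel_add _ _ _ _)

/-- An object of `B⁺ ∩ B⁻`, as an object of the heart. -/
def heartObj (X : B) (h : P.plus X ∧ P.minus X) : P.Heart := ⟨P.π.obj X, h⟩

/-- The morphism in the heart given by a morphism in `B`. -/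
def heartMap {Y Z : B} {hY : P.plus Y ∧ P.minus Y} {hZ : P.plus Z ∧ P.minus Z} (f : Y ⟶ Z) :
    heartObj Y hY ⟶ heartObj Z hZ := ObjectProperty.homMk (P.π.map f)

lemma heartObj_surjective (Y : P.Heart) : ∃ X h, heartObj X h = Y := ⟨Y.obj.as, Y.property, rfl⟩

section

variable {X Y Z : B} {hX : P.plus X ∧ P.minus X} {hY : P.plus Y ∧ P.minus Y}
  {hZ : P.plus Z ∧ P.minus Z}

lemma heartMap_surjective (f : heartObj Y hY ⟶ heartObj Z hZ) : ∃ g, heartMap g = f := by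
  obtain ⟨g, hg⟩ := P.π.map_surjective (X := Y) (Y := Z) f.hom
  exact ⟨g, ObjectProperty.hom_ext _ hg⟩

lemma heartMap_comp (f : X ⟶ Y) (g : Y ⟶ Z) :
    (heartMap (f ≫ g) : heartObj X hX ⟶ heartObj Z hZ) =
      (heartMap f : _ ⟶ heartObj Y hY) ≫ heartMap g :=
  ObjectProperty.hom_ext _ (P.π.map_comp _ _)

lemma heartMap_eq_iff {f g : Y ⟶ Z} :
    (heartMap f : heartObj Y hY ⟶ heartObj Z hZ) = heartMap g ↔ P.rel (f - g) 0 := by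
  rw [← rel_sub, ← map_eq_iff]
  exact ⟨fun h => congr(($h).hom), fun h => ObjectProperty.hom_ext _ h⟩

lemma heartMap_eq_zero_iff {f : Y ⟶ Z} :
    (heartMap f : heartObj Y hY ⟶ heartObj Z hZ) = 0 ↔ P.rel f 0 := by
  have : (heartMap 0 : heartObj Y hY ⟶ heartObj Z hZ) = 0 :=
    ObjectProperty.hom_ext _ (P.π.map_zero _ _)
  rw [← this, heartMap_eq_iff, sub_zero]

end

lemma IsReflection.mem_heart {X Z : B} {p : X ⟶ Z} (hp : P.IsReflection p) (hX : P.minus X) :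
    P.plus Z ∧ P.minus Z := ⟨hp.plus, hp.minus hX⟩

/-- On `B⁻`, the functor `H` is given by the reflection in `B⁺/W`. -/
lemma nonempty_iso_H {X Z : B} {p : X ⟶ Z} (hp : P.IsReflection p) (hX : P.minus X) :
    Nonempty (P.H.obj X ≅ heartObj Z (hp.mem_heart hX)) := by
  obtain ⟨e⟩ := nonempty_leftAdjoint_obj_iso (Adjunction.ofIsRightAdjoint P.qPlus.ι)
    (X := P.π.obj X) (Z := ⟨P.π.obj Z, hp.plus⟩) (P.π.map p) (fun Y f => by
      obtain ⟨f, rfl⟩ := P.π.map_surjective (X := X) (Y := Y.obj.as) f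
      obtain ⟨g, rfl⟩ := hp.lift _ Y.property f
      exact ⟨ObjectProperty.homMk (P.π.map g), (P.π.map_comp _ _).symm⟩)
    (fun Y g g' h => by
      obtain ⟨t, ht⟩ := P.π.map_surjective (X := Z) (Y := Y.obj.as) g.hom
      obtain ⟨t', ht'⟩ := P.π.map_surjective (X := Z) (Y := Y.obj.as) g'.hom
      have h₀ : P.π.map (p ≫ t) = P.π.map (p ≫ t') := by
        rw [P.π.map_comp, P.π.map_comp, ht, ht']
        exact h
      have h₁ := rel_sub.1 ((map_eq_iff _ _).1 h₀)
      rw [← Preadditive.comp_sub] at h₁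
      exact ObjectProperty.hom_ext _ (ht.symm.trans
        (((map_eq_iff _ _).2 (rel_sub.2 (hp.rel_zero Y.property h₁))).trans ht')))
  -- `Z` already lies in `B⁻`, so `σ⁻` does not change it.
  obtain ⟨e'⟩ := nonempty_rightAdjoint_obj_iso (Adjunction.ofIsLeftAdjoint P.qMinus.ι)
    ⟨P.π.obj Z, hp.minus hX⟩
  exact ⟨P.qHeart.isoMk (P.qMinus.ι.mapIso (P.sigmaMinus.mapIso (P.qPlus.ι.mapIso e) ≪≫ e'))⟩

/-- The cone `C` of a morphism `f : Y ⟶ Z` in `B⁻`, relative to an embedding of `Y` into the core: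
it is a weak cokernel of `f` in `B/W`, and a cokernel with respect to morphisms to `B⁺`. -/
lemma exists_cone {Y Z : B} (hY : P.minus Y) (hZ : P.minus Z) (f : Y ⟶ Z) :
    ∃ (W C : B) (k : Y ⟶ W) (b : W ⟶ C) (z : Z ⟶ C) (θ : T.Ext C Y), P.core W ∧
      T.Realizes (biprod.lift k (-f)) (biprod.desc b z) θ ∧ P.minus C ∧
      (∀ Q, P.plus Q → ∀ g : C ⟶ Q, P.rel (z ≫ g) 0 → P.rel g 0) ∧
      ∀ Q, ∀ g : Z ⟶ Q, P.rel (f ≫ g) 0 → ∃ h : C ⟶ Q, z ≫ h = g := by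
  obtain ⟨W, U, k, u, hW, hU, lam, hlam⟩ := hY
  obtain ⟨C, z, c, b, θ, h₁, h₂, h₃⟩ := exists_pushout hlam f
  refine ⟨W, C, k, b, z, θ, hW, h₃, minus_of_conflation ⟨_, h₁⟩ hZ hU,
    fun Q hQ g => rel_zero_of_conflation ⟨_, h₁⟩ hU hQ g, fun Q g hg => ?_⟩
  obtain ⟨W₀, a, b₀, hW₀, hab⟩ := rel_zero_iff.1 hg
  -- Extending `a` along `k` makes `(a' ≫ b₀, g)` vanish on the inflation `(k, -f)`, so it descends
  -- to `C`.
  obtain ⟨a', ha'⟩ := exists_extend hlam a (ext_zero hU hW₀.2 _)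
  obtain ⟨t, ht⟩ := exists_desc h₃ (biprod.desc (a' ≫ b₀) g) (by
    rw [biprod.lift_desc, reassoc_of% ha', Preadditive.neg_comp, hab, add_neg_cancel])
  exact ⟨t, by simpa using congr(biprod.inr ≫ $ht)⟩

lemma rel_zero_of_realizes {Y Z W C : B} {f : Y ⟶ Z} {k : Y ⟶ W} {b : W ⟶ C} {z : Z ⟶ C}
    {θ : T.Ext C Y} (h : T.Realizes (biprod.lift k (-f)) (biprod.desc b z) θ) (hW : P.core W) :
    P.rel (f ≫ z) 0 := by
  refine rel_zero_iff.2 ⟨W, k, b, hW, ?_⟩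
  have := comp_eq_zero h
  rw [biprod.lift_desc, Preadditive.neg_comp, ← sub_eq_add_neg, sub_eq_zero] at this
  exact this.symm

/-- The relative cone has the universal property against `B⁺` but need not lie there; its reflection
does. -/
lemma hasCokernel_heart {Y Z : P.Heart} (f : Y ⟶ Z) : HasCokernel f := by
  obtain ⟨Y, hY, rfl⟩ := heartObj_surjective Y
  obtain ⟨Z, hZ, rfl⟩ := heartObj_surjective Z
  obtain ⟨f, rfl⟩ := heartMap_surjective f
  obtain ⟨W, C, k, b, z, θ, hW, h, hC, hz, hz'⟩ := exists_cone hY.2 hZ.2 f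
  obtain ⟨Q, p, hp⟩ := exists_isReflection P C
  have w : (heartMap f : heartObj Y hY ⟶ heartObj Z hZ) ≫
      (heartMap (z ≫ p) : _ ⟶ heartObj Q (hp.mem_heart hC)) = 0 := by
    rw [← heartMap_comp, heartMap_eq_zero_iff, ← Category.assoc]
    exact rel_zero_comp_right (rel_zero_of_realizes h hW) p
  have hex (X : P.Heart) (g : heartObj Z hZ ⟶ X)
      (hg : (heartMap f : heartObj Y hY ⟶ heartObj Z hZ) ≫ g = 0) :
      ∃ t : heartObj Q (hp.mem_heart hC) ⟶ X, heartMap (z ≫ p) ≫ t = g := by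
    obtain ⟨X, hX, rfl⟩ := heartObj_surjective X
    obtain ⟨g, rfl⟩ := heartMap_surjective g
    rw [← heartMap_comp, heartMap_eq_zero_iff] at hg
    obtain ⟨t, rfl⟩ := hz' _ g hg
    obtain ⟨t', rfl⟩ := hp.lift _ hX.1 t
    exact ⟨heartMap t', by rw [← heartMap_comp, Category.assoc]⟩
  have hepi : Epi (heartMap (z ≫ p) : heartObj Z hZ ⟶ heartObj Q (hp.mem_heart hC)) := by
    refine Preadditive.epi_of_cancel_zero _ fun {X} g hg => ?_
    obtain ⟨X, hX, rfl⟩ := heartObj_surjective X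
    obtain ⟨g, rfl⟩ := heartMap_surjective g
    rw [← heartMap_comp, heartMap_eq_zero_iff, Category.assoc] at hg
    rw [heartMap_eq_zero_iff]
    exact hp.rel_zero hX.1 (hz _ hX.1 _ hg)
  exact ⟨⟨⟨_, CokernelCofork.IsColimit.ofπ _ w
    (fun g hg => (hex _ g hg).choose) (fun g hg => (hex _ g hg).choose_spec)
    (fun g hg m hm => hepi.left_cancellation _ _ (hm.trans (hex _ g hg).choose_spec.symm))⟩⟩⟩

/-- The cone of an epimorphism of the heart lies in `U`. -/
lemma U_of_epi {Y Z : B} {hY : P.plus Y ∧ P.minus Y} {hZ : P.plus Z ∧ P.minus Z} {f : Y ⟶ Z}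
    (hf : Epi (heartMap f : heartObj Y hY ⟶ heartObj Z hZ))
    {W C : B} {k : Y ⟶ W} {b : W ⟶ C} {z : Z ⟶ C} {θ : T.Ext C Y}
    (hW : P.core W) (h : T.Realizes (biprod.lift k (-f)) (biprod.desc b z) θ) (hC : P.minus C)
    (hz : ∀ Q, P.plus Q → ∀ g : C ⟶ Q, P.rel (z ≫ g) 0 → P.rel g 0) : P.U C := by
  obtain ⟨Q, p, hp⟩ := exists_isReflection P C
  -- The reflection of `C` is the cokernel of `f`, so it is reached from `Z` by zero; `hz` transfers
  -- this to `p`.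
  refine hp.mem_U (hz _ hp.plus _ ?_)
  have : (heartMap (z ≫ p) : heartObj Z hZ ⟶ heartObj Q (hp.mem_heart hC)) = 0 := by
    rw [← cancel_epi (heartMap f : heartObj Y hY ⟶ heartObj Z hZ), comp_zero, ← heartMap_comp,
      heartMap_eq_zero_iff, ← Category.assoc]
    exact rel_zero_comp_right (rel_zero_of_realizes h hW) p
  exact heartMap_eq_zero_iff.1 this

/-- Composed to the cone of `f`, which lies in `U`, the map `X → Z'` extends to the projective `D`
and then lifts to `W ⊞ Z'`. What remains comes from `Y`, and the correction through `D` vanishes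
modulo the core. -/
lemma projective_of_omega {X Z : B} {p : X ⟶ Z} (hp : P.IsReflection p)
    (hX : T.omega P.coheart X) :
    Projective (heartObj Z (hp.mem_heart (minus_of_omega hX))) where
  factors := by
    intro Y Z' g f hf
    obtain ⟨Y, hY, rfl⟩ := heartObj_surjective Y
    obtain ⟨Z', hZ', rfl⟩ := heartObj_surjective Z'
    obtain ⟨g, rfl⟩ := heartMap_surjective g
    obtain ⟨f, rfl⟩ := heartMap_surjective f
    obtain ⟨W, C, k, b, z, θ, hW, h, hC, hz, -⟩ := exists_cone hY.2 hZ'.2 f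
    have hCU := U_of_epi hf hW h hC hz
    obtain ⟨D, C', i, q, hD, hC', δ, hδ⟩ := hX
    obtain ⟨m, hm⟩ := exists_extend hδ ((p ≫ g) ≫ z) (hC' _ (kernel_of_U hCU) _)
    obtain ⟨n, hn⟩ := exists_colift h m (hD _ _)
    obtain ⟨l, hl⟩ := exists_lift h (biprod.lift 0 (p ≫ g) - i ≫ n) (by
      rw [Preadditive.sub_comp, Category.assoc, hn, hm, biprod.lift_desc, zero_comp, zero_add,
        sub_self])
    -- The sign compensates for `-f` in the inflation `(k, -f)`.
    obtain ⟨l', hl'⟩ := hp.lift _ hY.1 (-l)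
    refine ⟨heartMap l', ?_⟩
    rw [← heartMap_comp, heartMap_eq_iff]
    refine hp.rel_zero hZ'.1 ?_
    have e : p ≫ (l' ≫ f - g) = -(i ≫ n ≫ biprod.snd) := by
      have := congr($hl ≫ biprod.snd)
      simp only [Category.assoc, biprod.lift_snd, Preadditive.comp_neg,
        Preadditive.sub_comp] at this
      rw [Preadditive.comp_sub, reassoc_of% hl', Preadditive.neg_comp, this]
      abel
    rw [e]
    exact rel_zero_neg (rel_zero_comp_left (rel_zero_of_U _ (U_of_proj hD) hZ'.1) i)

lemma exists_reflection_of_HOmegaCoheart {Y : P.Heart} (hY : P.HOmegaCoheart Y) :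
    ∃ (X Z : B) (p : X ⟶ Z) (hp : P.IsReflection p) (hX : T.omega P.coheart X),
      Nonempty (heartObj Z (hp.mem_heart (minus_of_omega hX)) ≅ Y) := by
  obtain ⟨X, hX, ⟨e⟩⟩ := hY
  obtain ⟨Z, p, hp⟩ := exists_isReflection P X
  obtain ⟨e'⟩ := nonempty_iso_H hp (minus_of_omega hX)
  exact ⟨X, Z, p, hp, hX, ⟨e'.symm ≪≫ e⟩⟩

lemma projective_of_HOmegaCoheart {Y : P.Heart} (hY : P.HOmegaCoheart Y) : Projective Y := by
  obtain ⟨X, Z, p, hp, hX, ⟨e⟩⟩ := exists_reflection_of_HOmegaCoheart hY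
  exact Projective.of_iso e (projective_of_omega hp hX)

/-- A summand requires a complement; the cokernel of the section `s` provides one. -/
lemma isSummand_of_splitEpi {X Y : P.Heart} (f : Y ⟶ X) (s : X ⟶ Y) (h : s ≫ f = 𝟙 X) :
    IsSummand X Y := by
  have : IsSplitMono s := ⟨⟨⟨f, h⟩⟩⟩
  have := hasCokernel_heart s
  exact ⟨_, _, ⟨isBilimitBinaryBiconeOfIsSplitMonoOfCokernel (cokernelIsCokernel s)⟩,
    ⟨Iso.refl _⟩⟩

/-- Comparing `Y → K → C` with a projective cover `X → D → C` gives `a : X → Y` with `a_* ε = δ`. It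
induces the required epimorphism. -/
lemma exists_epi_of_cocone (hT : T.HasEnoughProj) (h : ∀ X : B, T.cocone P.kernel P.coheart X)
    (Y : P.Heart) : ∃ (X : P.Heart) (f : X ⟶ Y), P.HOmegaCoheart X ∧ Epi f := by
  obtain ⟨Y, hY, rfl⟩ := heartObj_surjective Y
  obtain ⟨K, C, x, y, hK, hC, δ, hδ⟩ := h Y
  obtain ⟨X, D, i, q, hD, ε, hε⟩ := hT C
  obtain ⟨l, hl⟩ := exists_colift hδ q (hD _ _)
  obtain ⟨a, ha, -⟩ := T.et3_op hε hδ l (𝟙 C) (by rw [hl, Category.comp_id])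
  rw [pull_id] at ha
  have hX : T.omega P.coheart X := ⟨D, C, i, q, hD, hC, ε, hε⟩
  obtain ⟨Z, p, hp⟩ := exists_isReflection P X
  obtain ⟨e⟩ := nonempty_iso_H hp (minus_of_omega hX)
  obtain ⟨g, rfl⟩ := hp.lift _ hY.1 a
  refine ⟨_, heartMap g, ⟨X, hX, ⟨e⟩⟩, Preadditive.epi_of_cancel_zero _ fun {Q} t ht => ?_⟩
  obtain ⟨Q, hQ, rfl⟩ := heartObj_surjective Q
  obtain ⟨t, rfl⟩ := heartMap_surjective t
  rw [← heartMap_comp, heartMap_eq_zero_iff] at ht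
  obtain ⟨W, b, c, hW, hbc⟩ := rel_zero_iff.1 (rel_zero_comp_left ht p)
  obtain ⟨b', rfl⟩ := exists_extend hε b (hC _ (kernel_of_U hW.1) _)
  -- `t_* δ` is the pushforward of `ε` along a map that factors through the inflation `i`, hence
  -- zero. So `t` extends over `K`.
  obtain ⟨t', rfl⟩ := exists_extend hδ t (by
    rw [← ha, ← push_comp, Category.assoc, hbc, push_comp, push_comp, push_eq_zero hε,
      map_zero, map_zero])
  rw [heartMap_eq_zero_iff]
  exact rel_zero_of_kernel x t' hY.2 hK hQ.1

/-- It suffices to embed each syzygy `A` of `U` into an object of the kernel with cone in the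
coheart. That object is the pushout of `X → D → C` along a map `a : X → A` inducing an epimorphism
in the heart. -/
lemma cone_of_exists_epi (hT : T.HasEnoughProj)
    (h : ∀ Y : P.Heart, ∃ (X : P.Heart) (f : X ⟶ Y), P.HOmegaCoheart X ∧ Epi f) (U : B)
    (hU : P.U U) : T.cone P.kernel P.coheart U := by
  refine cone_of_cocone hT fun {A D₀ j₀ q₀} hD₀ hA => ?_
  have hA' : P.minus A := minus_of_cocone ⟨D₀, U, j₀, q₀, U_of_proj hD₀, hU, hA⟩
  obtain ⟨Y, pA, hpA⟩ := exists_isReflection P A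
  obtain ⟨X', f, hX', hf⟩ := h (heartObj Y (hpA.mem_heart hA'))
  obtain ⟨X, Z, p, hp, hX, ⟨e⟩⟩ := exists_reflection_of_HOmegaCoheart hX'
  have hf' : Epi (e.hom ≫ f) := inferInstance
  obtain ⟨g, hg⟩ := heartMap_surjective (e.hom ≫ f)
  rw [← hg] at hf'
  obtain ⟨D, C, i, q, hD, hC, δ, hδ⟩ := hX
  obtain ⟨S, s, hS, σ, hσ⟩ := hpA.conflation
  -- As `E(C, S) = 0`, the obstruction to lifting `p ≫ g` along `pA` extends to `D`. Subtracting a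
  -- map through `D` leaves one that comes from `A`.
  obtain ⟨m, hm⟩ := exists_extend hδ ((p ≫ g) ≫ s) (hC _ (kernel_of_U hS) _)
  obtain ⟨m', hm'⟩ := exists_colift hσ m (hD _ _)
  obtain ⟨a, ha⟩ := exists_lift hσ (p ≫ g - i ≫ m')
    (by rw [Preadditive.sub_comp, ← hm, Category.assoc i, hm', sub_self])
  obtain ⟨Q, j, r, b, θ, h₁, -, h₂⟩ := exists_pushout hδ a
  have hQ : P.minus Q := minus_of_conflation ⟨_, h₁⟩ hA' (U_of_coheart hC)
  refine ⟨Q, C, j, r, kernel_of_U ?_, hC, _, h₁⟩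
  obtain ⟨Q', pQ, hpQ⟩ := exists_isReflection P Q
  -- `Q` is in `U` once its reflection map vanishes, which can be tested on `A`. There it becomes
  -- `pA ≫ t`, and `t` is killed by the epimorphism `g`.
  refine hpQ.mem_U (rel_zero_of_conflation ⟨_, h₁⟩ (U_of_coheart hC) hpQ.plus _ ?_)
  obtain ⟨t, ht⟩ := hpA.lift _ hpQ.plus (j ≫ pQ)
  have e₁ : i ≫ b = a ≫ j := by
    have := comp_eq_zero h₂
    rwa [biprod.lift_desc, Preadditive.neg_comp, ← sub_eq_add_neg, sub_eq_zero] at this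
  have e₂ : p ≫ g ≫ t = i ≫ (b ≫ pQ + m' ≫ t) := by
    have : p ≫ g = a ≫ pA + i ≫ m' := by rw [ha]; abel
    rw [← Category.assoc, this, Preadditive.add_comp, Preadditive.comp_add, Category.assoc, ht,
      reassoc_of% e₁, Category.assoc]
  have e₃ : P.rel (g ≫ t) 0 := hp.rel_zero hpQ.plus (by
    rw [e₂]
    exact rel_zero_comp_left (rel_zero_of_U _ (U_of_proj hD) hpQ.plus) i)
  have e₄ : (heartMap t : heartObj Y (hpA.mem_heart hA') ⟶ heartObj Q' (hpQ.mem_heart hQ)) = 0 := by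
    apply hf'.left_cancellation
    rw [comp_zero, ← heartMap_comp, heartMap_eq_zero_iff]
    exact e₃
  rw [← ht]
  exact rel_zero_comp_left (heartMap_eq_zero_iff.1 e₄) pA

end Extri.Extriangulated.CotorsionPair

/-! ### The equivalences and the projectives of the heart. -/

open Extri.Extriangulated.CotorsionPair in
theorem mainTheorem5 {B : Type u} [Category.{v} B] [Preadditive B] [HasZeroObject B]
    [HasBinaryBiproducts B] (T : Extri.Extriangulated.{w} B) (hT : T.HasEnoughProj)
    (P : T.CotorsionPair) :
    List.TFAE
      [∀ Y : P.Heart, ∃ (X : P.Heart) (f : X ⟶ Y), P.HOmegaCoheart X ∧ Epi f,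
        T.IsCotorsionPair P.coheart P.kernel,
        ∀ X : B, T.cocone P.kernel P.coheart X,
        ∀ X : B, P.U X → T.cone P.kernel P.coheart X] ∧
    ((∀ Y : P.Heart, ∃ (X : P.Heart) (f : X ⟶ Y), P.HOmegaCoheart X ∧ Epi f) →
      EnoughProjectives P.Heart ∧
        ∀ X : P.Heart, Projective X ↔ Extri.addClosure P.HOmegaCoheart X) := by
  refine ⟨?_, fun h => ⟨⟨fun Y => ?_⟩, fun X => ⟨fun (hX : Projective X) => ?_, ?_⟩⟩⟩
  · tfae_have 1 → 4 := cone_of_exists_epi hT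
    tfae_have 4 → 3 := cocone_of_cone
    tfae_have 3 → 2 := isCotorsionPair_coheart_kernel hT
    tfae_have 2 → 3 := fun h => h.coresolve
    tfae_have 3 → 1 := exists_epi_of_cocone hT
    tfae_finish
  · obtain ⟨X, f, hX, hf⟩ := h Y
    exact ⟨{ p := X, f := f, projective := projective_of_HOmegaCoheart hX, epi := hf }⟩
  · obtain ⟨Y, f, hY, hf⟩ := h X
    obtain ⟨s, hs⟩ := hX.factors (𝟙 X) f
    exact ⟨Y, hY, isSummand_of_splitEpi f s hs⟩
  · rintro ⟨Y, hY, hXY⟩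
    obtain ⟨-, i, r, -, -, hir, -⟩ := Extri.isSummand_iff.1 hXY
    exact projective_of_retract i r hir (projective_of_HOmegaCoheart hY)
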